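/- **Setting.** Let $n\ge 2$, $r\in\mathbb N$, and let $f_1,\dots,f_n:\mathbb R^r\to\mathbb R$ be differentiable functions such that, for some $\mu,L>0$, for all $i$ and all $x,x'\in\mathbb R^r$, $$\langle\nabla f_i(x)-\nabla f_i(x'),x-x'\rangle\ge\mu\|x-x'\|_2^2,\qquad \|\nabla f_i(x)-\nabla f_i(x')\|_2\le L\|x-x'\|_2 .$$ Let $x^\ast$ be the minimizer of $f=\frac1n\sum_{i=1}^n f_i$ on $\mathbb R^r$. Let $W=[w_{ij}]\in\mathbb R^{n\times n}$ be nonnegative, symmetric and doubly stochastic with $w_{ii}>0$ for all $i$, such that the graph on $\{1,\dots,n\}$ with an edge between $i\neq j$ whenever $w_{ij}>0$ is connected. Let $W_o$ be $W$ with its diagonal entries replaced by $0$, let $\rho(\cdot)$ denote the spectral radius, and put $$\rho_w=\rho\Big(W-\tfrac{\mathbf 1\mathbf 1^T}{n}\Big),\qquad T_w=1-\rho_w^2,\qquad d_I=\Big\|I-\tfrac{\mathbf 1\mathbf 1^T}{n}\Big\|_2,$$ where the norm $\|\boldsymbol x\|_2$ of a matrix is the Euclidean norm of the vector of the Euclidean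 norms of its columns (the Frobenius norm). Let $\boldsymbol\eta_k,\boldsymbol\xi_k$ $(k\ge 0)$ be random $n\times r$ matrices with rows $\eta_{i,k},\xi_{i,k}$, all of whose entries (over both sequences, all $k$, all rows and all columns) are independent, square integrable and have mean zero, and with $\mathbb E\|\boldsymbol\eta_k\|_2^2\le\sigma_\eta^2$, $\mathbb E\|\boldsymbol\xi_k\|_2^2\le\sigma_\xi^2$ for all $k$, where $\sigma_\eta,\sigma_\xi>0$. From arbitrary deterministic $s_{i,0},x_{i,0}\in\mathbb R^r$, Algorithm 1 with $\gamma_k=\beta_k=1$ and stepsize $\alpha>0$ computes, for $i=1,\dots,n$ and $k\ge 0$, $$s_{i,k+1}=w_{ii}s_{i,k}+\sum_{j\ne i}w_{ij}(s_{j,k}+\eta_{j,k})+\nabla f_i(x_{i,k}),\qquad x_{i,k+1}=w_{ii}x_{i,k}+\sum_{j\ne i}w_{ij}(x_{j,k}+\xi_{j,k})-\alpha(s_{i,k+1}-s_{i,k}).$$ Let $\boldsymbol x_k$ be the matrix with rows $x_{i,k}$, let $\bar x_k=\frac1n\sum_i x_{i,k}$, and let $\boldsymbol 1\bar x_k$ be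 the matrix all of whose rows are $\bar x_k$. **Theorem.** Let $d_1=\frac{128L^6d_I^2}{\mu(1-\rho_w^2)^2}$, $d_2=8\mu L^2d_I^2+\frac{128\mu d_I^2L^2}{(1-\rho_w^2)^2}$, $d_3=\frac{\mu(1-\rho_w^2)^2}{4}$, and suppose $$0<\alpha<\min\left\{\frac1{\mu+L},\ \frac{1-\rho_w^2}{4\sqrt2\,d_IL},\ \sqrt{\frac{2d_3}{d_2+\sqrt{d_2^2+4d_1d_3}}}\right\}.$$ Put $$A=\begin{bmatrix}1-\alpha\mu&\frac{2\alpha L^2}{\mu n}&0\\0&\frac{1+\rho_w^2}{2}&\frac{2\alpha^2}{1-\rho_w^2}\\ \frac{32n\alpha^2L^4d_I^2}{1-\rho_w^2}&\frac{64d_I^2L^2}{1-\rho_w^2}&\frac{1+\rho_w^2}{2}+\frac{16\alpha^2L^2d_I^2}{1-\rho_w^2}\end{bmatrix},\qquad B=\begin{bmatrix}\alpha^2\sigma_\eta^2+\sigma_\xi^2\\ nd_I^2\sigma_\xi^2\\ \frac{24nd_I^2}{1-\rho_w^2}\sigma_\eta^2+\frac{4nL^2d_I^2}{1-\rho_w^2}\sigma_\xi^2\end{bmatrix}\rho(W_o)^2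 .$$ Then $A$ is entrywise nonnegative, $\rho(A)<1$, and $I-A$ is invertible. Let $\theta_1,\theta_2$ be the first two entries of $(I-A)^{-1}B$. The quantities $\mathbb E\|\bar x_k-x^\ast\|_2^2$ and $\mathbb E\|\boldsymbol x_k-\boldsymbol 1\bar x_k\|_2^2$ are finite for every $k$ and bounded in $k$, and they converge linearly, at rate $\mathcal O(\rho(A)^k)$, to a neighborhood of zero: there is a constant $C$, independent of $k$, such that for all $k\ge 0$ $$\mathbb E\|\bar x_k-x^\ast\|_2^2\le\theta_1+C\rho(A)^k,\qquad \mathbb E\|\boldsymbol x_k-\boldsymbol 1\bar x_k\|_2^2\le\theta_2+C\rho(A)^k .$$ Moreover $$\lim_{k\to\infty}\sup_{l\ge k}\mathbb E\|\bar x_l-x^\ast\|_2^2=\limsup_{k\to\infty}\mathbb E\|\bar x_k-x^\ast\|_2^2\le\theta_1,\qquad \lim_{k\to\infty}\sup_{l\ge k}\mathbb E\|\boldsymbol x_l-\boldsymbol 1\bar x_l\|_2^2=\limsup_{k\to\infty}\mathbb E\|\boldsymbol x_k-\boldsymbol 1\bar x_k\|_2^2\le\theta_2,$$ and $$\theta_1=\frac{\alpha_1T_w^4+\alpha_2T_w^3+\alpha_3T_w^2+\alpha_4T_w+\alpha_5}{c_1T_w^4+c_2T_w^2+c_3}\,\rho(W_o)^2,\qquad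 \theta_2=\frac{\beta_1T_w^3+\beta_2T_w^2+\beta_3T_w+\beta_4}{c_1T_w^4+c_2T_w^2+c_3}\,\rho(W_o)^2,$$ with positive denominators, where $\alpha_1=\frac{\alpha^2}{4}\sigma_\eta^2+\frac14\sigma_\xi^2$, $\alpha_2=\frac{\alpha d_I^2L^2}{\mu}\sigma_\xi^2$, $\alpha_3=-8d_I^2\alpha^4L^2\sigma_\eta^2-8d_I^2\alpha^2L^2\sigma_\xi^2$, $\alpha_4=-\frac{32\alpha^3d_I^4L^4}{\mu}\sigma_\xi^2$, $\alpha_5=\big(\frac{96\alpha^3d_I^2L^2}{\mu}-128\alpha^4d_I^2L^2\big)\sigma_\eta^2+\big(\frac{16\alpha^3d_I^2L^4}{\mu}-128\alpha^2d_I^2L^2\big)\sigma_\xi^2$, $\beta_1=\frac{\alpha\mu}{2}nd_I^2\sigma_\xi^2$, $\beta_2=0$, $\beta_3=-16n\alpha^3\mu d_I^4L^2\sigma_\xi^2$, $\beta_4=\big(64n\alpha^6d_I^2L^4+48\mu n\alpha^3d_I^2\big)\sigma_\eta^2+\big(64n\alpha^4d_I^2L^4+8\mu n\alpha^3d_I^2L^2\big)\sigma_\xi^2$,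 $c_1=\frac{\alpha\mu}{4}$, $c_2=-8\alpha^3\mu d_I^2L^2$, $c_3=-\frac{128\alpha^5d_I^2L^6}{\mu}-128\alpha^3\mu d_I^2L^2$. -/

import Mathlib

open MeasureTheory ProbabilityTheory Filter Topology Matrix

noncomputable section

/-- The decision space `ℝ^r` with its Euclidean norm. -/
abbrev Vec (r : ℕ) : Type := EuclideanSpace ℝ (Fin r)

/-- The `n × r` matrices, stored as the family of their `n` rows. -/
abbrev Stack (n r : ℕ) : Type := Fin n → Vec r

/-- The squared Frobenius norm of a stacked variable. -/
def Stack.normSq {n r : ℕ} (x : Stack n r) : ℝ := ∑ i, ‖x i‖ ^ 2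

/-- The average of the rows. -/
def Stack.avg {n r : ℕ} (x : Stack n r) : Vec r := (n : ℝ)⁻¹ • ∑ i, x i

/-- The global objective `f = (1/n) ∑ fᵢ`. -/
def globalObj {n r : ℕ} (f : Fin n → Vec r → ℝ) (x : Vec r) : ℝ := (1 / (n : ℝ)) * ∑ i, f i x

/-- `g` is differentiable and `μ`-strongly convex, and its gradient is `L`-Lipschitz. -/
structure IsStronglyConvexSmooth {r : ℕ} (μ L : ℝ) (g : Vec r → ℝ) : Prop where
  differentiable : Differentiable ℝ g
  strongly_monotone : ∀ x y,
    μ * ‖x - y‖ ^ 2 ≤ inner ℝ (gradient g x - gradient g y) (x - y)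
  lipschitz : ∀ x y, ‖gradient g x - gradient g y‖ ≤ L * ‖x - y‖

/-- The undirected graph on the agents, with an edge between distinct `i`, `j` when the
coupling weight is positive. -/
def weightGraph {n : ℕ} (W : Matrix (Fin n) (Fin n) ℝ) : SimpleGraph (Fin n) :=
  SimpleGraph.fromRel fun i j => 0 < W i j

/-- Coupling matrices: nonnegative, doubly stochastic, symmetric, with positive diagonal and
connected induced graph. -/
structure IsCoupling {n : ℕ} (W : Matrix (Fin n) (Fin n) ℝ) : Prop where
  doubly_stochastic : W ∈ doublyStochastic ℝ (Fin n)
  symmetric : W.IsSymm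
  diag_pos : ∀ i, 0 < W i i
  connected : (weightGraph W).Connected

/-- The matrix `W_o`: `W` with its diagonal replaced by zeros. -/
def offDiagPart {n : ℕ} (W : Matrix (Fin n) (Fin n) ℝ) : Matrix (Fin n) (Fin n) ℝ :=
  Matrix.of fun i j => if i = j then 0 else W i j

/-- The averaging matrix `𝟏𝟏ᵀ / n`. -/
def avgMatrix (n : ℕ) : Matrix (Fin n) (Fin n) ℝ := Matrix.of fun _ _ => 1 / (n : ℝ)

/-- The spectral radius of a real square matrix: the largest modulus of a complex eigenvalue. -/
def specRad {m : ℕ} (M : Matrix (Fin m) (Fin m) ℝ) : ℝ :=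
  (spectralRadius ℂ (M.map (fun t : ℝ => (t : ℂ)))).toReal

/-- The matrix norm `d_I = ‖I - 𝟏𝟏ᵀ / n‖₂`, that is, the Euclidean norm of the vector of the
Euclidean norms of the columns. -/
def devNorm (n : ℕ) : ℝ := √(∑ j, ∑ i, ((1 - avgMatrix n) i j) ^ 2)

/-- `ρ_w = ρ(W - 𝟏𝟏ᵀ / n)`. -/
def mixRad {n : ℕ} (W : Matrix (Fin n) (Fin n) ℝ) : ℝ := specRad (W - avgMatrix n)

/-- The variables `s_k` and `x_k` of the algorithm. -/
structure AlgState (n r : ℕ) where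
  s : Stack n r
  x : Stack n r

/-- One iteration of the algorithm with stepsizes `α`, `γ`, noise factor `β` and injected
noises `η` (on `s`) and `ξ` (on `x`). -/
def algStep {n r : ℕ} (W : Matrix (Fin n) (Fin n) ℝ) (f : Fin n → Vec r → ℝ) (α γ β : ℝ)
    (η ξ : Stack n r) (z : AlgState n r) : AlgState n r :=
  let s' : Stack n r := fun i =>
    W i i • z.s i + ∑ j ∈ Finset.univ.erase i, W i j • (z.s j + β • η j)
      + γ • gradient (f i) (z.x i)
  let x' : Stack n r := fun i =>
    W i i • z.x i + ∑ j ∈ Finset.univ.erase i, W i j • (z.x j + β • ξ j)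
      - α • (s' i - z.s i)
  ⟨s', x'⟩

/-- The iterates of the algorithm started from `z₀`, for one realization of the noises. -/
def algRun {n r : ℕ} (W : Matrix (Fin n) (Fin n) ℝ) (f : Fin n → Vec r → ℝ) (α : ℝ)
    (γ β : ℕ → ℝ) (η ξ : ℕ → Stack n r) (z₀ : AlgState n r) : ℕ → AlgState n r
  | 0 => z₀
  | k + 1 => algStep W f α (γ k) (β k) (η k) (ξ k) (algRun W f α γ β η ξ z₀ k)

/-- The noise assumption: all scalar entries of the two noise sequences (over all iterations,
agents and coordinates) are independent, square integrable and of zero mean, and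
`𝔼‖η_k‖² ≤ ση²`, `𝔼‖ξ_k‖² ≤ σξ²` for all `k`. -/
structure IsNoise {n r : ℕ} {Ω : Type*} [MeasurableSpace Ω] (P : Measure Ω) (ση σξ : ℝ)
    (η ξ : ℕ → Ω → Stack n r) : Prop where
  measurable_η : ∀ k i j, Measurable fun ω => η k ω i j
  measurable_ξ : ∀ k i j, Measurable fun ω => ξ k ω i j
  indep : iIndepFun
    (Sum.elim (fun (e : ℕ × Fin n × Fin r) (ω : Ω) => η e.1 ω e.2.1 e.2.2)
      (fun (e : ℕ × Fin n × Fin r) (ω : Ω) => ξ e.1 ω e.2.1 e.2.2)) P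
  memLp_η : ∀ k i j, MemLp (fun ω => η k ω i j) 2 P
  memLp_ξ : ∀ k i j, MemLp (fun ω => ξ k ω i j) 2 P
  mean_η : ∀ k i j, ∫ ω, η k ω i j ∂P = 0
  mean_ξ : ∀ k i j, ∫ ω, ξ k ω i j ∂P = 0
  variance_η : ∀ k, ∫ ω, (η k ω).normSq ∂P ≤ ση ^ 2
  variance_ξ : ∀ k, ∫ ω, (ξ k ω).normSq ∂P ≤ σξ ^ 2

/-- `d₁ = 128 L⁶ d² / (μ (1 - ρ²)²)`, with `d = d_I` and `ρ = ρ_w`. -/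
def stepD₁ (μ L d ρ : ℝ) : ℝ := 128 * L ^ 6 * d ^ 2 / (μ * (1 - ρ ^ 2) ^ 2)

/-- `d₂ = 8 μ L² d² + 128 μ d² L² / (1 - ρ²)²`. -/
def stepD₂ (μ L d ρ : ℝ) : ℝ :=
  8 * μ * L ^ 2 * d ^ 2 + 128 * μ * d ^ 2 * L ^ 2 / (1 - ρ ^ 2) ^ 2

/-- `d₃ = μ (1 - ρ²)² / 4`. -/
def stepD₃ (μ ρ : ℝ) : ℝ := μ * (1 - ρ ^ 2) ^ 2 / 4

/-- The upper bound on the stepsize `α`. -/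
def stepBound (μ L d ρ : ℝ) : ℝ :=
  min (1 / (μ + L)) (min ((1 - ρ ^ 2) / (4 * √2 * d * L))
    (√(2 * stepD₃ μ ρ /
      (stepD₂ μ L d ρ + √(stepD₂ μ L d ρ ^ 2 + 4 * stepD₁ μ L d ρ * stepD₃ μ ρ)))))

/-- The `3 × 3` matrix `A`. -/
def rateMatrix (n : ℕ) (μ L α d ρ : ℝ) : Matrix (Fin 3) (Fin 3) ℝ :=
  !![1 - α * μ, 2 * α * L ^ 2 / (μ * n), 0;
     0, (1 + ρ ^ 2) / 2, 2 * α ^ 2 / (1 - ρ ^ 2);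
     32 * n * α ^ 2 * L ^ 4 * d ^ 2 / (1 - ρ ^ 2), 64 * d ^ 2 * L ^ 2 / (1 - ρ ^ 2),
       (1 + ρ ^ 2) / 2 + 16 * α ^ 2 * L ^ 2 * d ^ 2 / (1 - ρ ^ 2)]

/-- The vector `B`, with `ρo = ρ(W_o)`. -/
def noiseVec (n : ℕ) (L α d ρ ρo ση σξ : ℝ) : Fin 3 → ℝ :=
  ρo ^ 2 • ![α ^ 2 * ση ^ 2 + σξ ^ 2,
    n * d ^ 2 * σξ ^ 2,
    24 * n * d ^ 2 / (1 - ρ ^ 2) * ση ^ 2 + 4 * n * L ^ 2 * d ^ 2 / (1 - ρ ^ 2) * σξ ^ 2]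

/-- The vector `(I - A)⁻¹ B`. -/
def errVec (n : ℕ) (μ L α d ρ ρo ση σξ : ℝ) : Fin 3 → ℝ :=
  (1 - rateMatrix n μ L α d ρ)⁻¹ *ᵥ noiseVec n L α d ρ ρo ση σξ

/-- The common denominator `c₁ T⁴ + c₂ T² + c₃` of the explicit expressions. -/
def errDen (μ L α d T : ℝ) : ℝ :=
  α * μ / 4 * T ^ 4
    + (-8 * α ^ 3 * μ * d ^ 2 * L ^ 2) * T ^ 2
    + (-(128 * α ^ 5 * d ^ 2 * L ^ 6 / μ) - 128 * α ^ 3 * μ * d ^ 2 * L ^ 2)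

/-- The numerator `α₁ T⁴ + α₂ T³ + α₃ T² + α₄ T + α₅`. -/
def errNum₁ (μ L α d ση σξ T : ℝ) : ℝ :=
  (α ^ 2 / 4 * ση ^ 2 + 1 / 4 * σξ ^ 2) * T ^ 4
    + (α * d ^ 2 * L ^ 2 / μ * σξ ^ 2) * T ^ 3
    + (-8 * d ^ 2 * α ^ 4 * L ^ 2 * ση ^ 2 - 8 * d ^ 2 * α ^ 2 * L ^ 2 * σξ ^ 2) * T ^ 2
    + (-(32 * α ^ 3 * d ^ 4 * L ^ 4 / μ) * σξ ^ 2) * T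
    + ((96 * α ^ 3 * d ^ 2 * L ^ 2 / μ - 128 * α ^ 4 * d ^ 2 * L ^ 2) * ση ^ 2
      + (16 * α ^ 3 * d ^ 2 * L ^ 4 / μ - 128 * α ^ 2 * d ^ 2 * L ^ 2) * σξ ^ 2)

/-- The numerator `β₁ T³ + β₂ T² + β₃ T + β₄`, where `β₂ = 0`. -/
def errNum₂ (n : ℕ) (μ L α d ση σξ T : ℝ) : ℝ :=
  (α * μ / 2 * n * d ^ 2 * σξ ^ 2) * T ^ 3
    + 0 * T ^ 2
    + (-16 * n * α ^ 3 * μ * d ^ 4 * L ^ 2 * σξ ^ 2) * T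
    + ((64 * n * α ^ 6 * d ^ 2 * L ^ 4 + 48 * μ * n * α ^ 3 * d ^ 2) * ση ^ 2
      + (64 * n * α ^ 4 * d ^ 2 * L ^ 4 + 8 * μ * n * α ^ 3 * d ^ 2 * L ^ 2) * σξ ^ 2)

/-- The squared distance `‖x̄ - x⋆‖²` of the average to the optimum. -/
def optErr {n r : ℕ} (xstar : Vec r) (x : Stack n r) : ℝ := ‖x.avg - xstar‖ ^ 2

/-- The squared consensus error `‖x - 𝟏x̄‖²`. -/
def consErr {n r : ℕ} (x : Stack n r) : ℝ := Stack.normSq fun i => x i - x.avg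

end

/-! Write y_k = s_{k+1} - s_k, J = 𝟏𝟏ᵀ/n and T = 1 - ρ_w². The increments y_k track the gradients.
They satisfy y_{k+1} = W y_k + W_o(η_{k+1} - η_k) + ∇F(x_{k+1}) - ∇F(x_k), where ∇F stacks the local
gradients, and the average of y_k is the average gradient plus one fresh noise term, so noise does
not accumulate (`sIncr_algStep`).

Let u_k collect the mean squares of the optimality error, the consensus error and the deviation of
y_k from its average. Then u_{k+1} ≤ A u_k + B entrywise (`meanSq_succ_le_rateMatrix`). The first
row combines the contraction of a gradient step at the average (`norm_gradient_step_le`) with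
Lipschitz control of the disagreement. The other two rows rest on W contracting deviations by ρ_w
(`IsCoupling.normSq_dev_mix_le`) and a Young inequality tuned to that factor. Fresh noise is
uncorrelated with the past, so it only adds its variance.

The rest is linear algebra. The stepsize condition makes det(I - A) positive. Because of the sign
pattern of A, this gives a positive eigenvector v with eigenvalue λ in (0, 1), and λ = ρ(A). Since θ
= (I - A)⁻¹B satisfies θ = Aθ + B, the difference u_k - θ is dominated by a multiple of λ^k v. This
is the exact rate ρ(A)^k, with no polynomial factor. Cramer's rule gives the closed forms of θ. -/

/-! ### Contraction of a gradient step, via cocoercivity. -/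

section ConvexAnalysis

variable {E : Type*} [NormedAddCommGroup E] [InnerProductSpace ℝ E] [CompleteSpace E]

/-- Quadratic upper bound for a function whose gradient is one-sided Lipschitz. -/
lemma le_quadratic_of_gradient_oneSided {h : E → ℝ} {G : E → E} {M : ℝ}
    (hG : ∀ x, HasGradientAt h (G x) x)
    (hM : ∀ x y, inner ℝ (G x - G y) (x - y) ≤ M * ‖x - y‖ ^ 2) (x y : E) :
    h y ≤ h x + inner ℝ (G x) (y - x) + M / 2 * ‖y - x‖ ^ 2 := by
  set v := y - x with hv
  -- Up to the constant `h x`, this is h on the ray minus the claimed bound. Times t, its derivative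
  -- is nonpositive by `hM` at x + t v and x.
  let ψ : ℝ → ℝ := fun t => h (x + t • v) - t * inner ℝ (G x) v - M / 2 * t ^ 2 * ‖v‖ ^ 2
  have hder : ∀ t, HasDerivAt ψ
      (inner ℝ (G (x + t • v)) v - inner ℝ (G x) v - M * t * ‖v‖ ^ 2) t := by
    intro t
    have h1 : HasDerivAt (fun t : ℝ => x + t • v) v t := by
      simpa using ((hasDerivAt_id t).smul_const v).const_add x
    have h2 := (hG (x + t • v)).hasFDerivAt.comp_hasDerivAt t h1
    have h3 : HasDerivAt (fun t : ℝ => t * inner ℝ (G x) v) (inner ℝ (G x) v) t := by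
      simpa using (hasDerivAt_id t).mul_const (inner ℝ (G x) v)
    have h4 : HasDerivAt (fun t : ℝ => M / 2 * t ^ 2 * ‖v‖ ^ 2) (M * t * ‖v‖ ^ 2) t := by
      have := (((hasDerivAt_id' t).fun_pow 2).const_mul (M / 2)).mul_const (‖v‖ ^ 2)
      refine this.congr_deriv ?_
      rw [Nat.add_one_sub_one, pow_one]
      push_cast
      ring
    exact ((h2.sub h3).sub h4).congr_deriv (by simp)
  have hanti : AntitoneOn ψ (Set.Ici 0) := by
    refine antitoneOn_of_deriv_nonpos (convex_Ici 0)
      (fun t _ => (hder t).continuousAt.continuousWithinAt)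
      (fun t _ => (hder t).differentiableAt.differentiableWithinAt) fun t ht => ?_
    rw [interior_Ici, Set.mem_Ioi] at ht
    rw [(hder t).deriv]
    have := hM (x + t • v) x
    rw [add_sub_cancel_left, norm_smul, inner_smul_right, inner_sub_left, Real.norm_eq_abs, mul_pow,
      sq_abs] at this
    have h5 : t * (inner ℝ (G (x + t • v)) v - inner ℝ (G x) v - M * t * ‖v‖ ^ 2) ≤ 0 := by
      nlinarith
    nlinarith
  have := hanti (Set.mem_Ici.2 le_rfl) (Set.mem_Ici.2 zero_le_one) zero_le_one
  simp only [ψ, one_smul, zero_smul, add_zero, hv, add_sub_cancel] at this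
  simp only [hv]
  linarith

/-- Gradients of convex smooth functions are cocoercive. -/
lemma gradient_cocoercive {h : E → ℝ} {G : E → E} {M : ℝ} (hM0 : 0 < M)
    (hG : ∀ x, HasGradientAt h (G x) x)
    (hmono : ∀ x y, 0 ≤ inner ℝ (G x - G y) (x - y))
    (hM : ∀ x y, inner ℝ (G x - G y) (x - y) ≤ M * ‖x - y‖ ^ 2) (x y : E) :
    ‖G x - G y‖ ^ 2 ≤ M * inner ℝ (G x - G y) (x - y) := by
  have hconv : ∀ x y, h x + inner ℝ (G x) (y - x) ≤ h y := by
    intro x y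
    -- Monotonicity of G is the one-sided bound with constant 0 for -h, so the first-order convexity
    -- inequality is the same lemma.
    have := le_quadratic_of_gradient_oneSided (h := fun z => -h z) (G := fun z => -G z) (M := 0)
      (fun z => by
        have := (hG z).hasFDerivAt.neg
        rw [hasGradientAt_iff_hasFDerivAt, map_neg]
        exact this)
      (fun x y => by
        have := hmono x y
        rw [neg_sub_neg, ← neg_sub, inner_neg_left]; linarith) x y
    rw [inner_neg_left] at this
    linarith
  have key : ∀ x y, h x + inner ℝ (G x) (y - x) + 1 / (2 * M) * ‖G y - G x‖ ^ 2 ≤ h y := by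
    intro x y
    -- The test point minimizes the quadratic upper bound at y once the linear function with slope G
    -- x is subtracted.
    have h1 := hconv x (y - (1 / M) • (G y - G x))
    have h2 := le_quadratic_of_gradient_oneSided hG hM y (y - (1 / M) • (G y - G x))
    rw [sub_sub_cancel_left, norm_neg, norm_smul, inner_neg_right, inner_smul_right, mul_pow,
      Real.norm_eq_abs, sq_abs] at h2
    rw [sub_right_comm, inner_sub_right, inner_smul_right] at h1
    have h3 : ‖G y - G x‖ ^ 2 = inner ℝ (G y) (G y - G x) - inner ℝ (G x) (G y - G x) := by
      rw [← inner_sub_left, real_inner_self_eq_norm_sq]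
    have h4 : M / 2 * ((1 / M) ^ 2 * ‖G y - G x‖ ^ 2) = 1 / (2 * M) * ‖G y - G x‖ ^ 2 := by
      field_simp
    have h5 : 1 / M * inner ℝ (G y) (G y - G x) - 1 / M * inner ℝ (G x) (G y - G x)
        = 2 * (1 / (2 * M) * ‖G y - G x‖ ^ 2) := by
      rw [h3]; field_simp
    linarith
  have h1 := key x y
  have h2 := key y x
  have h3 : inner ℝ (G x - G y) (x - y) = -inner ℝ (G x) (y - x) - inner ℝ (G y) (x - y) := by
    rw [inner_sub_left, ← neg_sub x y, inner_neg_right]; ring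
  rw [norm_sub_rev (G y)] at h1
  have h4 : 1 / M * ‖G x - G y‖ ^ 2 ≤ inner ℝ (G x - G y) (x - y) := by
    rw [h3]
    have : 1 / M * ‖G x - G y‖ ^ 2 = 2 * (1 / (2 * M) * ‖G x - G y‖ ^ 2) := by field_simp
    linarith
  rw [one_div, inv_mul_le_iff₀ hM0] at h4
  exact h4

/-- A gradient step on a strongly convex smooth function is a contraction. -/
lemma norm_gradient_step_le {f : E → ℝ} {G : E → E} {μ L α : ℝ} (hμ : 0 < μ) (hL : 0 < L)
    (hα : 0 ≤ α) (hαle : α * (μ + L) ≤ 1)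
    (hG : ∀ x, HasGradientAt f (G x) x)
    (hmono : ∀ x y, μ * ‖x - y‖ ^ 2 ≤ inner ℝ (G x - G y) (x - y))
    (hLip : ∀ x y, ‖G x - G y‖ ≤ L * ‖x - y‖) (x y : E) :
    ‖(x - α • G x) - (y - α • G y)‖ ≤ (1 - α * μ) * ‖x - y‖ := by
  -- Removing the strongly convex part turns the step into (1 - αμ) times the identity minus α times
  -- a cocoercive map, which isolates the factor 1 - αμ.
  have hH : ∀ x, HasGradientAt (fun z => f z - μ / 2 * ‖z‖ ^ 2) (G x - μ • x) x := by
    intro x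
    rw [hasGradientAt_iff_hasFDerivAt]
    have h1 := (hG x).hasFDerivAt.sub
      (((hasStrictFDerivAt_norm_sq (F := E) x).hasFDerivAt).const_mul (μ / 2))
    refine h1.congr_fderiv ?_
    ext v
    simp
    ring
  have hinner : ∀ x y, inner ℝ ((G x - μ • x) - (G y - μ • y)) (x - y)
      = inner ℝ (G x - G y) (x - y) - μ * ‖x - y‖ ^ 2 := by
    intro x y
    rw [sub_sub_sub_comm, ← smul_sub, inner_sub_left, real_inner_smul_left,
      real_inner_self_eq_norm_sq]
  have hco := gradient_cocoercive (M := L) hL hH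
    (fun x y => by rw [hinner]; linarith [hmono x y])
    (fun x y => by
      rw [hinner]
      have h1 := real_inner_le_norm (G x - G y) (x - y)
      have h2 := mul_le_mul_of_nonneg_right (hLip x y) (norm_nonneg (x - y))
      nlinarith [mul_nonneg hμ.le (sq_nonneg ‖x - y‖)]) x y
  have h0 : 0 ≤ inner ℝ ((G x - μ • x) - (G y - μ • y)) (x - y) := by
    rw [hinner]; linarith [hmono x y]
  set u := (G x - μ • x) - (G y - μ • y) with hu
  have hαμ : 0 ≤ 1 - α * μ := by nlinarith
  refine le_of_sq_le_sq ?_ (by positivity)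
  have h1 : (x - α • G x) - (y - α • G y) = (1 - α * μ) • (x - y) - α • u := by
    rw [hu]; module
  rw [h1, norm_sub_sq_real, norm_smul, norm_smul, real_inner_smul_left, real_inner_smul_right,
    real_inner_comm, Real.norm_of_nonneg hαμ, Real.norm_of_nonneg hα, mul_pow α]
  have h2 := mul_le_mul_of_nonneg_left hco (sq_nonneg α)
  -- The cross term absorbs α²‖u‖² ≤ α²L⟨u, x - y⟩, since α(μ + L) ≤ 1 gives 2(1 - αμ) ≥ αL.
  have h3 : 0 ≤ α * inner ℝ u (x - y) * (2 * (1 - α * μ) - α * L) := by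
    apply mul_nonneg (mul_nonneg hα h0)
    nlinarith [mul_nonneg hα hL.le]
  nlinarith

end ConvexAnalysis

/-! ### Optimality condition at the minimizer. -/

section Objectives

variable {r n : ℕ} {μ L : ℝ}

lemma IsStronglyConvexSmooth.hasGradientAt {g : Vec r → ℝ} (hg : IsStronglyConvexSmooth μ L g)
    (x : Vec r) : HasGradientAt g (gradient g x) x :=
  (hg.differentiable x).hasGradientAt

/-- The average of the gradients vanishes at the minimizer of the global objective. -/
lemma avg_gradient_minimizer_eq_zero {f : Fin n → Vec r → ℝ}
    (hf : ∀ i, IsStronglyConvexSmooth μ L (f i)) {xstar : Vec r}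
    (hx : ∀ x, globalObj f xstar ≤ globalObj f x) :
    Stack.avg (fun i => gradient (f i) xstar) = 0 := by
  have h1 : HasGradientAt (globalObj f) (Stack.avg fun i => gradient (f i) xstar) xstar := by
    rw [hasGradientAt_iff_hasFDerivAt]
    have := (HasFDerivAt.fun_sum fun i (_ : i ∈ Finset.univ) =>
      ((hf i).hasGradientAt xstar).hasFDerivAt).const_mul (1 / (n : ℝ))
    refine this.congr_fderiv ?_
    simp [Stack.avg, map_sum]
  have h2 : IsLocalMin (globalObj f) xstar := Filter.Eventually.of_forall hx
  have h3 := h2.hasFDerivAt_eq_zero h1.hasFDerivAt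
  simpa using h3

end Objectives

/-! ### Spectral radius as an operator norm for symmetric matrices. -/

section SpectralNorm

open scoped Matrix.Norms.L2Operator in
/-- The spectral radius of a symmetric matrix bounds its Euclidean operator norm. -/
lemma sum_sq_mulVec_le_specRad {m : ℕ} {M : Matrix (Fin m) (Fin m) ℝ} (hM : M.IsSymm)
    (z : Fin m → ℝ) : ∑ i, (M *ᵥ z) i ^ 2 ≤ specRad M ^ 2 * ∑ i, z i ^ 2 := by
  set N : Matrix (Fin m) (Fin m) ℂ := M.map (fun t : ℝ => (t : ℂ)) with hN
  have hsa : IsSelfAdjoint N := by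
    rw [IsSelfAdjoint, star_eq_conjTranspose]
    ext i j
    simp [hN, hM.apply i j]
  -- In a C⋆-algebra the norm of a self-adjoint element is its spectral radius.
  have hrad : specRad M = ‖N‖ := by
    rw [specRad, hsa.spectralRadius_eq_nnnorm]
    rfl
  have h := Matrix.l2_opNorm_mulVec N (WithLp.toLp 2 fun i => (z i : ℂ))
  have h1 : N *ᵥ (fun i => (z i : ℂ)) = fun i => (((M *ᵥ z) i : ℝ) : ℂ) := by
    ext i
    simp [hN, Matrix.mulVec, dotProduct]
  have hsq := pow_le_pow_left₀ (norm_nonneg _) h 2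
  rw [mul_pow, EuclideanSpace.norm_sq_eq, EuclideanSpace.norm_sq_eq] at hsq
  simp only at hsq
  rw [h1] at hsq
  simpa [hrad] using hsq

end SpectralNorm

/-! ### Stacked variables: mixing, averages and deviations. -/

section Stacks

variable {n r : ℕ}

/-- Left multiplication of a stacked variable by a matrix. -/
def mix (M : Matrix (Fin n) (Fin n) ℝ) : Stack n r →ₗ[ℝ] Stack n r where
  toFun x i := ∑ j, M i j • x j
  map_add' x y := by ext1 i; simp [Finset.sum_add_distrib]
  map_smul' c x := by ext1 i; simp [Finset.smul_sum, smul_comm c]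

lemma mix_apply (M : Matrix (Fin n) (Fin n) ℝ) (x : Stack n r) (i : Fin n) :
    mix M x i = ∑ j, M i j • x j := rfl

lemma mix_mul (M N : Matrix (Fin n) (Fin n) ℝ) (x : Stack n r) :
    mix (M * N) x = mix M (mix N x) := by
  ext1 i
  simp only [mix_apply, Matrix.mul_apply, Finset.sum_smul, Finset.smul_sum, mul_smul]
  exact Finset.sum_comm

lemma mix_sub_left (M N : Matrix (Fin n) (Fin n) ℝ) (x : Stack n r) :
    mix (M - N) x = mix M x - mix N x := by
  ext1 i
  simp [mix_apply, sub_smul]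

lemma mix_one (x : Stack n r) : mix (1 : Matrix (Fin n) (Fin n) ℝ) x = x := by
  ext1 i
  simp [mix_apply, Matrix.one_apply]

lemma mix_avgMatrix (x : Stack n r) (i : Fin n) : mix (avgMatrix n) x i = x.avg := by
  simp [mix_apply, avgMatrix, Stack.avg, Finset.smul_sum]

/-- The deviation of the rows from their average. -/
noncomputable def Stack.dev (x : Stack n r) : Stack n r := mix (1 - avgMatrix n) x

lemma Stack.dev_apply (x : Stack n r) (i : Fin n) : x.dev i = x i - x.avg := by
  rw [Stack.dev, mix_sub_left, mix_one, Pi.sub_apply, mix_avgMatrix]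

lemma consErr_eq (x : Stack n r) : consErr x = x.dev.normSq := by
  simp only [consErr, Stack.normSq, Stack.dev_apply]

lemma Stack.avg_add (x y : Stack n r) : (x + y).avg = x.avg + y.avg := by
  simp [Stack.avg, Finset.sum_add_distrib]

lemma Stack.avg_sub (x y : Stack n r) : (x - y).avg = x.avg - y.avg := by
  simp [Stack.avg, smul_sub]

lemma Stack.avg_smul (c : ℝ) (x : Stack n r) : (c • x).avg = c • x.avg := by
  simp [Stack.avg, ← Finset.smul_sum, smul_comm c]

lemma Stack.dev_add (x y : Stack n r) : (x + y).dev = x.dev + y.dev := map_add _ x y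

lemma Stack.dev_sub (x y : Stack n r) : (x - y).dev = x.dev - y.dev := map_sub _ x y

lemma Stack.dev_smul (c : ℝ) (x : Stack n r) : (c • x).dev = c • x.dev := map_smul _ c x

lemma Stack.normSq_nonneg (x : Stack n r) : 0 ≤ x.normSq :=
  Finset.sum_nonneg fun _ _ => by positivity

lemma Stack.normSq_smul (c : ℝ) (x : Stack n r) : (c • x).normSq = c ^ 2 * x.normSq := by
  simp [Stack.normSq, norm_smul, mul_pow, Finset.mul_sum]

lemma Stack.normSq_add (x y : Stack n r) :
    (x + y).normSq = x.normSq + 2 * ∑ i, inner ℝ (x i) (y i) + y.normSq := by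
  simp only [Stack.normSq, Pi.add_apply, norm_add_sq_real, Finset.sum_add_distrib, Finset.mul_sum]

/-- Young's inequality for the cross term. The weight stays free: 1 serves for crude splittings, and
a tuned value is needed where a contraction factor must survive. -/
lemma norm_add_sq_le_weighted {E : Type*} [NormedAddCommGroup E] [InnerProductSpace ℝ E] {c : ℝ}
    (hc : 0 < c) (a b : E) : ‖a + b‖ ^ 2 ≤ (1 + c) * ‖a‖ ^ 2 + (1 + c⁻¹) * ‖b‖ ^ 2 := by
  have h := real_inner_le_norm a b
  rw [norm_add_sq_real]
  have h1 : 0 ≤ c⁻¹ * (c * ‖a‖ - ‖b‖) ^ 2 := by positivity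
  have h2 : c⁻¹ * (c * ‖a‖ - ‖b‖) ^ 2 = c * ‖a‖ ^ 2 - 2 * (‖a‖ * ‖b‖) + c⁻¹ * ‖b‖ ^ 2 := by
    field_simp; ring
  linarith

lemma Stack.normSq_add_le_weighted {c : ℝ} (hc : 0 < c) (x y : Stack n r) :
    (x + y).normSq ≤ (1 + c) * x.normSq + (1 + c⁻¹) * y.normSq := by
  simp only [Stack.normSq, Finset.mul_sum, ← Finset.sum_add_distrib]
  exact Finset.sum_le_sum fun i _ => norm_add_sq_le_weighted hc (x i) (y i)

lemma Stack.normSq_add_le (x y : Stack n r) :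
    (x + y).normSq ≤ 2 * x.normSq + 2 * y.normSq := by
  have := Stack.normSq_add_le_weighted one_pos x y
  norm_num at this
  linarith

lemma Stack.normSq_neg (x : Stack n r) : (-x).normSq = x.normSq := by
  simp [Stack.normSq]

lemma Stack.normSq_sub_le (x y : Stack n r) :
    (x - y).normSq ≤ 2 * x.normSq + 2 * y.normSq := by
  have := Stack.normSq_add_le x (-y)
  rwa [Stack.normSq_neg, ← sub_eq_add_neg] at this

lemma Stack.sum_dev (hn : 0 < n) (x : Stack n r) : ∑ i, x.dev i = 0 := by
  have : (n : ℝ) ≠ 0 := by positivity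
  simp only [Stack.dev_apply, Finset.sum_sub_distrib, Finset.sum_const, Finset.card_univ,
    Fintype.card_fin, Stack.avg, ← Nat.cast_smul_eq_nsmul ℝ, smul_smul, mul_inv_cancel₀ this,
    one_smul, sub_self]

/-- Pythagoras for a deviation and a stack with constant rows. -/
lemma Stack.normSq_add_const (x : Stack n r) (hx : ∑ i, x i = 0) (v : Vec r) :
    (x + fun _ => v).normSq = x.normSq + n * ‖v‖ ^ 2 := by
  rw [Stack.normSq_add, ← sum_inner, hx]
  simp [Stack.normSq]

/-- Bias-variance splitting: deviations sum to zero, so they are orthogonal to the constant stack.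
-/
lemma Stack.sum_sq_sub (hn : 0 < n) (x : Stack n r) (v : Vec r) :
    ∑ i, ‖x i - v‖ ^ 2 = x.dev.normSq + n * ‖x.avg - v‖ ^ 2 := by
  rw [← Stack.normSq_add_const _ (Stack.sum_dev hn x)]
  refine Finset.sum_congr rfl fun i _ => ?_
  rw [Pi.add_apply, Stack.dev_apply, sub_add_sub_cancel]

lemma Stack.normSq_eq_dev_add (hn : 0 < n) (x : Stack n r) :
    x.normSq = x.dev.normSq + n * ‖x.avg‖ ^ 2 := by
  simpa [Stack.normSq] using Stack.sum_sq_sub hn x 0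

lemma Stack.normSq_dev_le (hn : 0 < n) (x : Stack n r) : x.dev.normSq ≤ x.normSq := by
  rw [Stack.normSq_eq_dev_add hn x]
  exact le_add_of_nonneg_right (by positivity)

lemma Stack.card_mul_norm_avg_sq_le (hn : 0 < n) (x : Stack n r) :
    n * ‖x.avg‖ ^ 2 ≤ x.normSq := by
  rw [Stack.normSq_eq_dev_add hn x]
  exact le_add_of_nonneg_left (Stack.normSq_nonneg _)

lemma Stack.normSq_eq_sum_coord (x : Stack n r) : x.normSq = ∑ c, ∑ i, x i c ^ 2 := by
  rw [Finset.sum_comm]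
  simp [Stack.normSq, EuclideanSpace.norm_sq_eq]

/-- The matrix acts on each of the r columns separately, so the operator norm bound applies
coordinate by coordinate. -/
lemma normSq_mix_le {M : Matrix (Fin n) (Fin n) ℝ} (hM : M.IsSymm) (x : Stack n r) :
    (mix M x).normSq ≤ specRad M ^ 2 * x.normSq := by
  rw [Stack.normSq_eq_sum_coord, Stack.normSq_eq_sum_coord, Finset.mul_sum]
  refine Finset.sum_le_sum fun c _ => ?_
  refine le_of_eq_of_le (Finset.sum_congr rfl fun i _ => ?_)
    (sum_sq_mulVec_le_specRad hM fun i => x i c)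
  simp [mix_apply, Matrix.mulVec, dotProduct]

lemma avgMatrix_isSymm : (avgMatrix n).IsSymm := by
  ext i j
  simp [avgMatrix]

lemma offDiagPart_isSymm {W : Matrix (Fin n) (Fin n) ℝ} (hW : W.IsSymm) :
    (offDiagPart W).IsSymm := by
  ext i j
  simp [offDiagPart, eq_comm, hW.apply]

variable {W : Matrix (Fin n) (Fin n) ℝ}

lemma IsCoupling.mul_avgMatrix (hW : IsCoupling W) : W * avgMatrix n = avgMatrix n := by
  ext i j
  have := (mem_doublyStochastic_iff_sum.1 hW.doubly_stochastic).2.1 i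
  simp [Matrix.mul_apply, avgMatrix, ← Finset.sum_mul, this]

lemma IsCoupling.avgMatrix_mul (hW : IsCoupling W) : avgMatrix n * W = avgMatrix n := by
  ext i j
  have := (mem_doublyStochastic_iff_sum.1 hW.doubly_stochastic).2.2 j
  simp [Matrix.mul_apply, avgMatrix, ← Finset.mul_sum, this]

lemma avgMatrix_mul_avgMatrix (hn : 0 < n) : avgMatrix n * avgMatrix n = avgMatrix n := by
  have : (n : ℝ) ≠ 0 := by positivity
  ext i j
  simp [Matrix.mul_apply, avgMatrix, this]

lemma IsCoupling.avg_mix (hW : IsCoupling W) (hn : 0 < n) (x : Stack n r) :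
    (mix W x).avg = x.avg := by
  rw [← mix_avgMatrix _ ⟨0, hn⟩, ← mix_mul, hW.avgMatrix_mul, mix_avgMatrix]

/-- From WJ = JW = J² = J one gets (I - J)W = W - J = (W - J)(I - J). -/
lemma IsCoupling.dev_mix (hW : IsCoupling W) (hn : 0 < n) (x : Stack n r) :
    (mix W x).dev = mix (W - avgMatrix n) x.dev := by
  rw [Stack.dev, Stack.dev, ← mix_mul, ← mix_mul, sub_mul, one_mul, hW.avgMatrix_mul, mul_sub,
    mul_one, sub_mul, hW.mul_avgMatrix, avgMatrix_mul_avgMatrix hn, sub_self, sub_zero]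

lemma IsCoupling.normSq_dev_mix_le (hW : IsCoupling W) (hn : 0 < n) (x : Stack n r) :
    (mix W x).dev.normSq ≤ mixRad W ^ 2 * x.dev.normSq := by
  rw [hW.dev_mix hn]
  exact normSq_mix_le (hW.symmetric.sub avgMatrix_isSymm) _

/-- I - J is a projection of rank n - 1. The value matters only through d_I² ≥ 1 for n ≥ 2, which
lets the powers of d_I in A and B absorb constants. -/
lemma devNorm_sq (hn : 0 < n) : devNorm n ^ 2 = n - 1 := by
  have hn' : (n : ℝ) ≠ 0 := by positivity
  have h : ∀ i j : Fin n, ((1 - avgMatrix n) i j) ^ 2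
      = (if i = j then 1 - 2 / (n : ℝ) else 0) + (1 / n) ^ 2 := by
    intro i j
    rw [Matrix.sub_apply, Matrix.one_apply, avgMatrix, Matrix.of_apply]
    split_ifs <;> ring
  rw [devNorm, Real.sq_sqrt (Finset.sum_nonneg fun _ _ => Finset.sum_nonneg fun _ _ => sq_nonneg _)]
  simp only [h, Finset.sum_add_distrib, Finset.sum_ite_eq', Finset.mem_univ, if_true,
    Finset.sum_const, Finset.card_univ, Fintype.card_fin, nsmul_eq_mul]
  field_simp
  ring

end Stacks

/-! ### Nonnegative matrices with a positive eigenvector. -/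

section Perron

variable {m : ℕ} {A : Matrix (Fin m) (Fin m) ℝ} {v : Fin m → ℝ} {lam : ℝ}

/-- The eigenvalue of a positive eigenvector of a nonnegative matrix is the spectral radius. -/
lemma specRad_eq_of_pos_eigenvector [NeZero m] (hA : ∀ i j, 0 ≤ A i j) (hv : ∀ i, 0 < v i)
    (hlam : 0 ≤ lam) (hAv : A *ᵥ v = lam • v) : specRad A = lam := by
  set N : Matrix (Fin m) (Fin m) ℂ := A.map (fun t : ℝ => (t : ℂ)) with hN
  have hmem : (lam : ℂ) ∈ spectrum ℂ N := by
    rw [← Matrix.spectrum_toLin', ← Module.End.hasEigenvalue_iff_mem_spectrum]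
    refine Module.End.hasEigenvalue_of_hasEigenvector (x := fun i => (v i : ℂ)) ?_
    rw [Module.End.hasEigenvector_iff, Module.End.mem_eigenspace_iff]
    constructor
    · ext i
      have := congrFun hAv i
      simp only [Matrix.mulVec, dotProduct, Pi.smul_apply, smul_eq_mul] at this
      rw [Matrix.toLin'_apply]
      simp only [hN, Matrix.mulVec, dotProduct, Matrix.map_apply, Pi.smul_apply, smul_eq_mul]
      exact_mod_cast this
    · intro h
      have := congrFun h 0
      simp only [Pi.zero_apply, Complex.ofReal_eq_zero] at this
      exact (hv 0).ne' this
  have hle : ∀ z ∈ spectrum ℂ N, ‖z‖ ≤ lam := by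
    intro z hz
    rw [← Matrix.spectrum_toLin', ← Module.End.hasEigenvalue_iff_mem_spectrum] at hz
    obtain ⟨u, hu⟩ := hz.exists_hasEigenvector
    obtain ⟨hu1, hu2⟩ := Module.End.hasEigenvector_iff.1 hu
    rw [Module.End.mem_eigenspace_iff, Matrix.toLin'_apply] at hu1
    -- In the sup norm weighted by v the matrix has norm `lam`; the row where an eigenvector attains
    -- this norm bounds its eigenvalue.
    obtain ⟨i, -, hi⟩ := Finset.exists_max_image Finset.univ (fun i => ‖u i‖ / v i)
      ⟨0, Finset.mem_univ _⟩
    have hbound : ∀ j, ‖u j‖ ≤ ‖u i‖ / v i * v j := fun j => by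
      rw [← div_le_iff₀ (hv j)]
      exact hi j (Finset.mem_univ j)
    have hpos : 0 < ‖u i‖ := by
      by_contra h
      have h0 : ‖u i‖ = 0 := le_antisymm (not_lt.1 h) (norm_nonneg _)
      refine hu2 (funext fun j => norm_le_zero_iff.1 ?_)
      simpa [h0] using hbound j
    have h1 : ‖z‖ * ‖u i‖ ≤ lam * ‖u i‖ := by
      calc ‖z‖ * ‖u i‖ = ‖(N *ᵥ u) i‖ := by rw [hu1, Pi.smul_apply, norm_smul]
        _ ≤ ∑ j, ‖N i j * u j‖ := norm_sum_le Finset.univ fun j => N i j * u j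
        _ ≤ ∑ j, A i j * (‖u i‖ / v i * v j) := by
          refine Finset.sum_le_sum fun j _ => ?_
          rw [norm_mul, hN, Matrix.map_apply, Complex.norm_real, Real.norm_of_nonneg (hA i j)]
          exact mul_le_mul_of_nonneg_left (hbound j) (hA i j)
        _ = ‖u i‖ / v i * (A *ᵥ v) i := by
          simp only [Matrix.mulVec, dotProduct, Finset.mul_sum]
          exact Finset.sum_congr rfl fun j _ => by ring
        _ = lam * ‖u i‖ := by
          rw [hAv, Pi.smul_apply, smul_eq_mul]
          have := (hv i).ne'
          field_simp
    exact le_of_mul_le_mul_right h1 hpos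
  have hrad : spectralRadius ℂ N = ENNReal.ofReal lam := by
    apply le_antisymm
    · refine iSup₂_le fun z hz => ?_
      rw [← enorm_eq_nnnorm, ← ofReal_norm]
      exact ENNReal.ofReal_le_ofReal (hle z hz)
    · refine le_trans (le_of_eq ?_) (le_iSup₂ (f := fun z (_ : z ∈ spectrum ℂ N) =>
        (‖z‖₊ : ENNReal)) (lam : ℂ) hmem)
      rw [← enorm_eq_nnnorm, ← ofReal_norm, Complex.norm_real, Real.norm_of_nonneg hlam]
  rw [specRad, ← hN, hrad, ENNReal.toReal_ofReal hlam]

/-- Geometric bound for a sequence dominated by a nonnegative matrix with a positive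
eigenvector. -/
lemma exists_le_mul_pow_of_le_mulVec [NeZero m] (hA : ∀ i j, 0 ≤ A i j) (hv : ∀ i, 0 < v i)
    (hlam : 0 ≤ lam) (hAv : A *ᵥ v = lam • v) {u : ℕ → Fin m → ℝ}
    (hu : ∀ k i, u (k + 1) i ≤ (A *ᵥ u k) i) : ∃ C, ∀ k i, u k i ≤ C * lam ^ k := by
  obtain ⟨i₀, -, hi₀⟩ := Finset.exists_max_image Finset.univ (fun i => |u 0 i| / v i)
    ⟨0, Finset.mem_univ _⟩
  obtain ⟨i₁, -, hi₁⟩ := Finset.exists_max_image Finset.univ v ⟨0, Finset.mem_univ _⟩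
  -- The least D with |u 0| ≤ D v. Only upper bounds propagate, so later entries may be negative.
  set D := |u 0 i₀| / v i₀ with hD
  have hD0 : 0 ≤ D := div_nonneg (abs_nonneg _) (hv _).le
  have key : ∀ k i, u k i ≤ D * lam ^ k * v i := by
    intro k
    induction k with
    | zero =>
      intro i
      rw [pow_zero, mul_one]
      refine (le_abs_self _).trans ?_
      rw [← div_le_iff₀ (hv i)]
      exact hi₀ i (Finset.mem_univ i)
    | succ k ih =>
      intro i
      calc u (k + 1) i ≤ ∑ j, A i j * u k j := hu k i
        _ ≤ ∑ j, A i j * (D * lam ^ k * v j) :=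
          Finset.sum_le_sum fun j _ => mul_le_mul_of_nonneg_left (ih j) (hA i j)
        _ = D * lam ^ k * (A *ᵥ v) i := by
          simp only [Matrix.mulVec, dotProduct, Finset.mul_sum]
          exact Finset.sum_congr rfl fun j _ => by ring
        _ = D * lam ^ (k + 1) * v i := by
          rw [hAv, Pi.smul_apply, smul_eq_mul]; ring
  refine ⟨D * v i₁, fun k i => (key k i).trans ?_⟩
  calc D * lam ^ k * v i ≤ D * lam ^ k * v i₁ :=
        mul_le_mul_of_nonneg_left (hi₁ i (Finset.mem_univ i)) (mul_nonneg hD0 (pow_nonneg hlam k))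
    _ = D * v i₁ * lam ^ k := by ring

/-- A cyclic nonnegative `3 × 3` matrix with diagonal below one and `det (1 - A) > 0` has a
positive eigenvector with eigenvalue in `(0, 1)`. -/
lemma exists_pos_eigenvector_cyclic {a b c e f g h : ℝ} (ha0 : 0 ≤ a) (ha : a < 1)
    (hc : c < 1) (hb : 0 < b) (he : 0 < e) (hf : 0 < f) (hg : 0 ≤ g)
    (hdet : 0 < (1 - a) * ((1 - c) * (1 - h) - e * g) - b * e * f) :
    ∃ lam : ℝ, 0 < lam ∧ lam < 1 ∧ ∃ v : Fin 3 → ℝ, (∀ i, 0 < v i) ∧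
      !![a, b, 0; 0, c, e; f, g, h] *ᵥ v = lam • v := by
  -- The characteristic polynomial: negative at max(a, c), and det(I - A) > 0 at 1, so it has a root
  -- strictly between.
  let p : ℝ → ℝ := fun t => (t - a) * ((t - c) * (t - h) - e * g) - b * e * f
  have hpc : ContinuousOn p (Set.Icc (max a c) 1) := by fun_prop
  have hbef : 0 < b * e * f := by positivity
  have hp0 : p (max a c) < 0 := by
    simp only [p]
    rcases max_cases a c with ⟨h1, h2⟩ | ⟨h1, h2⟩ <;> rw [h1]
    · simpa using hbef
    · have : 0 ≤ (c - a) * (e * g) := mul_nonneg (by linarith) (by positivity)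
      rw [sub_self]; nlinarith
  obtain ⟨t, ⟨ht0, ht1⟩, hpt⟩ := intermediate_value_Ioo (max_lt ha hc).le hpc ⟨hp0, hdet⟩
  have hta : 0 < t - a := sub_pos.2 ((le_max_left a c).trans_lt ht0)
  have htc : 0 < t - c := sub_pos.2 ((le_max_right a c).trans_lt ht0)
  -- The first two rows fix the eigenvector up to scale, with positive entries because t exceeds a
  -- and c; the third row is then p(t) = 0.
  refine ⟨t, by linarith, ht1, ![b * e, e * (t - a), (t - a) * (t - c)], ?_, ?_⟩
  · intro i; fin_cases i <;> simp <;> positivity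
  · ext i
    fin_cases i
    · simp [Matrix.mulVec, dotProduct, Fin.sum_univ_three]; ring
    · simp [Matrix.mulVec, dotProduct, Fin.sum_univ_three]; ring
    · simp [Matrix.mulVec, dotProduct, Fin.sum_univ_three]
      simp only [p] at hpt
      linarith

end Perron

/-! ### Tail suprema and limits superior. -/

section Limsup

/-- Suprema of the tails of a bounded real sequence converge to its limit superior. -/
lemma tendsto_iSup_Ici_limsup {u : ℕ → ℝ} (ha : BddAbove (Set.range u))
    (hb : BddBelow (Set.range u)) :
    Tendsto (fun k : ℕ => ⨆ l : Set.Ici k, u (l : ℕ)) atTop (𝓝 (limsup u atTop)) := by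
  have hbdd : ∀ k : ℕ, BddAbove (Set.range fun l : Set.Ici k => u (l : ℕ)) := fun k =>
    ha.mono (by rintro _ ⟨l, rfl⟩; exact ⟨(l : ℕ), rfl⟩)
  have hanti : Antitone fun k : ℕ => ⨆ l : Set.Ici k, u (l : ℕ) := by
    intro k k' hk
    exact ciSup_le fun l => le_ciSup (hbdd k) (⟨l, hk.trans l.2⟩ : Set.Ici k)
  have hbelow : BddBelow (Set.range fun k : ℕ => ⨆ l : Set.Ici k, u (l : ℕ)) := by
    obtain ⟨c, hc⟩ := hb
    refine ⟨c, ?_⟩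
    rintro _ ⟨k, rfl⟩
    exact (hc ⟨k, rfl⟩).trans (le_ciSup (hbdd k) (⟨k, Set.mem_Ici.2 le_rfl⟩ : Set.Ici k))
  have hcob : IsCoboundedUnder (· ≤ ·) atTop u := hb.isBoundedUnder_of_range.isCoboundedUnder_le
  have hbu : IsBoundedUnder (· ≤ ·) atTop u := ha.isBoundedUnder_of_range
  have heq : limsup u atTop = ⨅ k : ℕ, ⨆ l : Set.Ici k, u (l : ℕ) := by
    apply le_antisymm
    · refine le_ciInf fun k => limsup_le_of_le hcob ?_
      filter_upwards [Ici_mem_atTop k] with l hl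
      exact le_ciSup (hbdd k) (⟨l, hl⟩ : Set.Ici k)
    · refine le_of_forall_gt fun c hc => ?_
      obtain ⟨c', h1, h2⟩ := exists_between hc
      obtain ⟨k, hk⟩ := eventually_atTop.1 (eventually_lt_of_limsup_lt h1 hbu)
      exact ((ciInf_le hbelow k).trans (ciSup_le fun l => (hk l l.2).le)).trans_lt h2
  rw [heq]
  exact tendsto_atTop_ciInf hanti hbelow

lemma limsup_le_of_le_add_mul_pow {u : ℕ → ℝ} {a C q : ℝ} (hb : BddBelow (Set.range u))
    (hq0 : 0 ≤ q) (hq1 : q < 1) (h : ∀ k, u k ≤ a + C * q ^ k) : limsup u atTop ≤ a := by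
  have ht : Tendsto (fun k => a + C * q ^ k) atTop (𝓝 a) := by
    simpa using ((tendsto_pow_atTop_nhds_zero_of_lt_one hq0 hq1).const_mul C).const_add a
  rw [← ht.limsup_eq]
  exact limsup_le_limsup (Eventually.of_forall h)
    (hb.isBoundedUnder_of_range.isCoboundedUnder_le) ht.isBoundedUnder_le

lemma bddAbove_of_le_add_mul_pow {u : ℕ → ℝ} {a C q : ℝ}
    (hq0 : 0 ≤ q) (hq1 : q < 1) (h : ∀ k, u k ≤ a + C * q ^ k) : BddAbove (Set.range u) := by
  refine ⟨a + |C|, ?_⟩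
  rintro _ ⟨k, rfl⟩
  have h1 := mul_le_mul (le_abs_self C) (pow_le_one₀ hq0 hq1.le (n := k)) (pow_nonneg hq0 k)
    (abs_nonneg C)
  linarith [h k]

end Limsup

/-! ### The stepsize condition and the spectral radius of A. -/

section RateMatrix

variable {n : ℕ} {μ L α d ρ : ℝ}

/-- The consequences of the stepsize condition that the analysis uses. -/
lemma stepsize_facts (hμ : 0 < μ) (hL : 0 < L) (hα : 0 < α) (hd : 0 < d)
    (h : α < stepBound μ L d ρ) :
    α * (μ + L) < 1 ∧ 0 < 1 - ρ ^ 2 ∧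
      stepD₁ μ L d ρ * α ^ 4 + stepD₂ μ L d ρ * α ^ 2 < stepD₃ μ ρ := by
  obtain ⟨h1, h2⟩ := lt_min_iff.1 h
  obtain ⟨h2, h3⟩ := lt_min_iff.1 h2
  rw [lt_div_iff₀ (by positivity)] at h1
  rw [lt_div_iff₀ (by positivity)] at h2
  -- As α > 0, the second term of the minimum already forces ρ_w² < 1.
  have hT : 0 < 1 - ρ ^ 2 := lt_trans (by positivity) h2
  refine ⟨h1, hT, ?_⟩
  · have hD1 : 0 < stepD₁ μ L d ρ := by unfold stepD₁; positivity
    have hD2 : 0 < stepD₂ μ L d ρ := by unfold stepD₂; positivity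
    have hD3 : 0 < stepD₃ μ ρ := by unfold stepD₃; positivity
    generalize stepD₁ μ L d ρ = D₁ at *
    generalize stepD₂ μ L d ρ = D₂ at *
    generalize stepD₃ μ ρ = D₃ at *
    set s := √(D₂ ^ 2 + 4 * D₁ * D₃) with hs
    have hs2 : s ^ 2 = D₂ ^ 2 + 4 * D₁ * D₃ := Real.sq_sqrt (by positivity)
    have hs0 : 0 ≤ s := Real.sqrt_nonneg _
    have h4 : α ^ 2 < 2 * D₃ / (D₂ + s) := by rwa [← Real.lt_sqrt hα.le]
    rw [lt_div_iff₀ (by positivity)] at h4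
    -- The third bound is the positive root of D₁y² + D₂y = D₃ in y = α², with rationalized
    -- numerator: 2D₃/(D₂ + s) = (s - D₂)/(2D₁).
    have h5 : (2 * D₁ * α ^ 2 + D₂ - s) * (D₂ + s) < 0 := by nlinarith
    have h6 : 2 * D₁ * α ^ 2 + D₂ < s := by
      by_contra hcon
      have : 0 ≤ (2 * D₁ * α ^ 2 + D₂ - s) * (D₂ + s) :=
        mul_nonneg (by linarith) (by positivity)
      linarith
    have h7 : (2 * D₁ * α ^ 2 + D₂) ^ 2 < s ^ 2 :=
      pow_lt_pow_left₀ h6 (by positivity) two_ne_zero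
    rw [hs2] at h7
    have h8 : 4 * D₁ * (D₁ * α ^ 4 + D₂ * α ^ 2) < 4 * D₁ * D₃ := by linarith
    exact lt_of_mul_lt_mul_left h8 (by positivity)

/-- The denominator factors as αT²(d₃ - d₁α⁴ - d₂α²), so the quadratic stepsize condition is exactly
its positivity. -/
lemma errDen_pos (hμ : 0 < μ) (hα : 0 < α) (hT : 0 < 1 - ρ ^ 2)
    (h : stepD₁ μ L d ρ * α ^ 4 + stepD₂ μ L d ρ * α ^ 2 < stepD₃ μ ρ) :
    0 < errDen μ L α d (1 - ρ ^ 2) := by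
  have h1 : errDen μ L α d (1 - ρ ^ 2) = α * (1 - ρ ^ 2) ^ 2 *
      (stepD₃ μ ρ - (stepD₁ μ L d ρ * α ^ 4 + stepD₂ μ L d ρ * α ^ 2)) := by
    unfold errDen stepD₁ stepD₂ stepD₃
    generalize 1 - ρ ^ 2 = T at *
    field_simp
    ring
  rw [h1]
  have := sub_pos.2 h
  positivity

/-- This links the two roles of the denominator: it certifies ρ(A) < 1, and it is the denominator in
Cramer's rule. -/
lemma det_one_sub_rateMatrix (hn : 0 < n) (hμ : 0 < μ) (hT : 0 < 1 - ρ ^ 2) :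
    (1 - rateMatrix n μ L α d ρ).det = errDen μ L α d (1 - ρ ^ 2) / (1 - ρ ^ 2) ^ 2 := by
  have hn' : (n : ℝ) ≠ 0 := by positivity
  have hρ : ρ ^ 2 = 1 - (1 - ρ ^ 2) := by ring
  rw [Matrix.det_fin_three]
  simp [rateMatrix, errDen]
  generalize 1 - ρ ^ 2 = T at *
  rw [hρ]
  field_simp
  ring

lemma rateMatrix_nonneg (hμ : 0 < μ) (hL : 0 < L) (hα : 0 < α) (hαL : α * (μ + L) < 1)
    (hT : 0 < 1 - ρ ^ 2) (i j : Fin 3) : 0 ≤ rateMatrix n μ L α d ρ i j := by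
  have h1 : 0 ≤ 1 - α * μ := by nlinarith
  fin_cases i <;> fin_cases j <;> simp [rateMatrix] <;> first | linarith | positivity

lemma exists_pos_eigenvector_rateMatrix (hn : 0 < n) (hμ : 0 < μ) (hL : 0 < L) (hα : 0 < α)
    (hd : 0 < d) (hαL : α * (μ + L) < 1) (hT : 0 < 1 - ρ ^ 2)
    (hden : 0 < errDen μ L α d (1 - ρ ^ 2)) :
    ∃ lam : ℝ, 0 < lam ∧ lam < 1 ∧ ∃ v : Fin 3 → ℝ, (∀ i, 0 < v i) ∧
      rateMatrix n μ L α d ρ *ᵥ v = lam • v := by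
  have hdet : 0 < (1 - rateMatrix n μ L α d ρ).det := by
    rw [det_one_sub_rateMatrix hn hμ hT]
    positivity
  have hαμ : 0 < α * μ := by positivity
  refine exists_pos_eigenvector_cyclic (by nlinarith) (by linarith) (by linarith) (by positivity)
    (by positivity) (by positivity) (by positivity) ?_
  rw [Matrix.det_fin_three] at hdet
  simp [rateMatrix] at hdet
  linarith

end RateMatrix

/-! ### Closed forms of the error bounds. -/

section ErrVec

variable {n : ℕ} {μ L α d ρ ρo ση σξ : ℝ}

lemma one_sub_rateMatrix_mulVec_errVec (h : IsUnit (1 - rateMatrix n μ L α d ρ).det) :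
    (1 - rateMatrix n μ L α d ρ) *ᵥ errVec n μ L α d ρ ρo ση σξ
      = noiseVec n L α d ρ ρo ση σξ := by
  rw [errVec, Matrix.mulVec_mulVec, Matrix.mul_nonsing_inv _ h, Matrix.one_mulVec]

/-- Cramer's rule: each numerator is T² times an entry of adj(I - A)B, the factor T² coming from the
determinant. -/
lemma errVec_eq (hn : 0 < n) (hμ : 0 < μ) (hT : 0 < 1 - ρ ^ 2)
    (hden : 0 < errDen μ L α d (1 - ρ ^ 2)) :
    errVec n μ L α d ρ ρo ση σξ 0
      = errNum₁ μ L α d ση σξ (1 - ρ ^ 2) / errDen μ L α d (1 - ρ ^ 2) * ρo ^ 2 ∧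
    errVec n μ L α d ρ ρo ση σξ 1
      = errNum₂ n μ L α d ση σξ (1 - ρ ^ 2) / errDen μ L α d (1 - ρ ^ 2) * ρo ^ 2 := by
  have hn' : (n : ℝ) ≠ 0 := by positivity
  have hinv : errVec n μ L α d ρ ρo ση σξ = (errDen μ L α d (1 - ρ ^ 2) / (1 - ρ ^ 2) ^ 2)⁻¹ •
      ((1 - rateMatrix n μ L α d ρ).adjugate *ᵥ noiseVec n L α d ρ ρo ση σξ) := by
    rw [errVec, Matrix.inv_def, det_one_sub_rateMatrix hn hμ hT, Ring.inverse_eq_inv',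
      Matrix.smul_mulVec]
  have hρ : ρ ^ 2 = 1 - (1 - ρ ^ 2) := by ring
  have hrow : ∀ {i : Fin 3} {N : ℝ},
      (1 - ρ ^ 2) ^ 2 *
        ((1 - rateMatrix n μ L α d ρ).adjugate *ᵥ noiseVec n L α d ρ ρo ση σξ) i = N * ρo ^ 2 →
      errVec n μ L α d ρ ρo ση σξ i = N / errDen μ L α d (1 - ρ ^ 2) * ρo ^ 2 := by
    intro i N h
    rw [hinv, Pi.smul_apply, smul_eq_mul, div_mul_eq_mul_div, ← h]
    have := hden.ne'
    field_simp
  constructor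
  · apply hrow
    rw [Matrix.adjugate_fin_three]
    simp [rateMatrix, noiseVec, errNum₁, Matrix.mulVec, dotProduct, Fin.sum_univ_three]
    generalize 1 - ρ ^ 2 = T at *
    rw [hρ]
    field_simp
    ring
  · apply hrow
    rw [Matrix.adjugate_fin_three]
    simp [rateMatrix, noiseVec, errNum₂, Matrix.mulVec, dotProduct, Fin.sum_univ_three]
    generalize 1 - ρ ^ 2 = T at *
    rw [hρ]
    field_simp
    ring

end ErrVec

/-! ### Pathwise estimates for one iteration. -/

section Recursion

variable {n r : ℕ} {μ L : ℝ} {f : Fin n → Vec r → ℝ} {W : Matrix (Fin n) (Fin n) ℝ} {α : ℝ}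

/-- The stacked local gradients. -/
noncomputable def gradStack (f : Fin n → Vec r → ℝ) (x : Stack n r) : Stack n r :=
  fun i => gradient (f i) (x i)

/-- The increment of the variable `s`. -/
noncomputable def sIncr (W : Matrix (Fin n) (Fin n) ℝ) (f : Fin n → Vec r → ℝ) (η : Stack n r)
    (z : AlgState n r) : Stack n r :=
  mix W z.s - z.s + mix (offDiagPart W) η + gradStack f z.x

lemma smul_add_sum_erase_eq_mix (W : Matrix (Fin n) (Fin n) ℝ) (x η : Stack n r) (i : Fin n) :
    W i i • x i + ∑ j ∈ Finset.univ.erase i, W i j • (x j + (1 : ℝ) • η j)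
      = (mix W x + mix (offDiagPart W) η) i := by
  have h1 : mix W x i = W i i • x i + ∑ j ∈ Finset.univ.erase i, W i j • x j :=
    (Finset.add_sum_erase _ _ (Finset.mem_univ i)).symm
  have h2 : mix (offDiagPart W) η i = ∑ j ∈ Finset.univ.erase i, W i j • η j := by
    rw [mix_apply, ← Finset.add_sum_erase _ _ (Finset.mem_univ i)]
    simp only [offDiagPart, Matrix.of_apply, if_true, zero_smul, zero_add]
    refine Finset.sum_congr rfl fun j hj => ?_
    rw [if_neg (Finset.ne_of_mem_erase hj).symm]
  rw [Pi.add_apply, h1, h2]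
  simp only [one_smul, smul_add, Finset.sum_add_distrib]
  abel

lemma algStep_s (η ξ : Stack n r) (z : AlgState n r) :
    (algStep W f α 1 1 η ξ z).s = z.s + sIncr W f η z := by
  ext1 i
  have h : (algStep W f α 1 1 η ξ z).s i = W i i • z.s i
      + ∑ j ∈ Finset.univ.erase i, W i j • (z.s j + (1 : ℝ) • η j)
      + (1 : ℝ) • gradient (f i) (z.x i) := rfl
  rw [h, smul_add_sum_erase_eq_mix]
  simp only [sIncr, gradStack, one_smul, Pi.add_apply, Pi.sub_apply]
  abel

lemma algStep_x (η ξ : Stack n r) (z : AlgState n r) :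
    (algStep W f α 1 1 η ξ z).x
      = mix W z.x + mix (offDiagPart W) ξ - α • sIncr W f η z := by
  have h := algStep_s (W := W) (f := f) (α := α) η ξ z
  ext1 i
  have h' := congrFun h i
  have hx : (algStep W f α 1 1 η ξ z).x i = W i i • z.x i
      + ∑ j ∈ Finset.univ.erase i, W i j • (z.x j + (1 : ℝ) • ξ j)
      - α • ((algStep W f α 1 1 η ξ z).s i - z.s i) := rfl
  rw [hx, h', smul_add_sum_erase_eq_mix]
  simp

/-- Gradient tracking: s grows by its own increment y, so (W - I)s grows by Wy - y, while the noise
and gradient terms are replaced by their new values. -/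
lemma sIncr_algStep (η η' ξ : Stack n r) (z : AlgState n r) :
    sIncr W f η' (algStep W f α 1 1 η ξ z) = mix W (sIncr W f η z)
      + (mix (offDiagPart W) η' - mix (offDiagPart W) η
        + (gradStack f (algStep W f α 1 1 η ξ z).x - gradStack f z.x)) := by
  rw [sIncr, algStep_s, map_add]
  have h : gradStack f z.x = sIncr W f η z - mix W z.s + z.s - mix (offDiagPart W) η := by
    rw [sIncr]; abel
  rw [h]
  abel

variable (hf : ∀ i, IsStronglyConvexSmooth μ L (f i))
include hf

lemma normSq_gradStack_sub_le (x y : Stack n r) :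
    (gradStack f x - gradStack f y).normSq ≤ L ^ 2 * (x - y).normSq := by
  rw [Stack.normSq, Stack.normSq, Finset.mul_sum]
  refine Finset.sum_le_sum fun i _ => ?_
  rw [← mul_pow]
  exact pow_le_pow_left₀ (norm_nonneg _) ((hf i).lipschitz _ _) 2

/-- The average gradient vanishes at the minimizer and can be subtracted for free; the Lipschitz
bound then leaves squared distances to x⋆, which split by `Stack.sum_sq_sub`. -/
lemma card_mul_norm_avg_gradStack_sq_le (hn : 0 < n) {xstar : Vec r}
    (hx : ∀ x, globalObj f xstar ≤ globalObj f x) (x : Stack n r) :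
    n * ‖(gradStack f x).avg‖ ^ 2 ≤ L ^ 2 * (x.dev.normSq + n * ‖x.avg - xstar‖ ^ 2) := by
  have h1 : (gradStack f x).avg = (gradStack f x - gradStack f fun _ => xstar).avg := by
    rw [Stack.avg_sub]
    have : (gradStack f fun _ => xstar).avg = 0 := avg_gradient_minimizer_eq_zero hf hx
    rw [this, sub_zero]
  rw [h1, ← Stack.sum_sq_sub hn]
  exact (Stack.card_mul_norm_avg_sq_le hn _).trans (normSq_gradStack_sub_le hf _ _)

/-- One noiseless step of the average towards the optimum. -/
lemma norm_avg_step_sq_le (hn : 0 < n) (hμ : 0 < μ) (hL : 0 < L) (hα : 0 < α)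
    (hαL : α * (μ + L) < 1) {xstar : Vec r}
    (hx : ∀ x, globalObj f xstar ≤ globalObj f x) (x : Stack n r) :
    ‖x.avg - xstar - α • (gradStack f x).avg‖ ^ 2
      ≤ (1 - α * μ) * ‖x.avg - xstar‖ ^ 2 + 2 * α * L ^ 2 / (μ * n) * x.dev.normSq := by
  have hn' : (0 : ℝ) < n := by exact_mod_cast hn
  have hαμ : 0 < 1 - α * μ := by nlinarith
  -- `a` is an exact gradient step from the average; `b` is the error from evaluating the gradients
  -- at the disagreeing rows.
  set a : Vec r := x.avg - xstar - α • (gradStack f fun _ => x.avg).avg with ha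
  set b : Vec r := α • (gradStack f (fun _ => x.avg) - gradStack f x).avg with hb
  have hab : x.avg - xstar - α • (gradStack f x).avg = a + b := by
    rw [ha, hb, Stack.avg_sub]; module
  have hna : ‖a‖ ≤ (1 - α * μ) * ‖x.avg - xstar‖ := by
    have hstar : (gradStack f fun _ => xstar).avg = 0 := avg_gradient_minimizer_eq_zero hf hx
    have hconst : ∀ v : Vec r, (n : ℝ)⁻¹ • ∑ _i : Fin n, v = v := by
      intro v
      rw [Finset.sum_const, Finset.card_univ, Fintype.card_fin, ← Nat.cast_smul_eq_nsmul ℝ,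
        smul_smul, inv_mul_cancel₀ hn'.ne', one_smul]
    have h1 : a = (n : ℝ)⁻¹ • ∑ i, ((x.avg - α • gradient (f i) x.avg)
        - (xstar - α • gradient (f i) xstar)) := by
      rw [Finset.sum_sub_distrib, Finset.sum_sub_distrib, Finset.sum_sub_distrib, smul_sub,
        smul_sub, smul_sub, hconst, hconst, ← Finset.smul_sum, ← Finset.smul_sum,
        smul_comm _ α, smul_comm _ α]
      have h2 : (n : ℝ)⁻¹ • ∑ i, gradient (f i) xstar = 0 := hstar
      rw [h2, ha, smul_zero, sub_zero, sub_right_comm]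
      rfl
    rw [h1, norm_smul, Real.norm_of_nonneg (by positivity), inv_mul_le_iff₀ hn']
    refine (norm_sum_le _ _).trans ?_
    refine (Finset.sum_le_sum fun i _ => norm_gradient_step_le hμ hL hα.le hαL.le
      (hf i).hasGradientAt (hf i).strongly_monotone (hf i).lipschitz x.avg xstar).trans_eq ?_
    simp
  have hnb : ‖b‖ ^ 2 ≤ α ^ 2 * (L ^ 2 / n * x.dev.normSq) := by
    rw [hb, norm_smul, mul_pow, Real.norm_eq_abs, sq_abs]
    refine mul_le_mul_of_nonneg_left ?_ (sq_nonneg α)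
    rw [div_mul_eq_mul_div, le_div_iff₀' hn']
    refine (Stack.card_mul_norm_avg_sq_le hn _).trans
      ((normSq_gradStack_sub_le hf _ _).trans_eq ?_)
    congr 1
    refine Finset.sum_congr rfl fun i _ => ?_
    rw [Stack.dev_apply, Pi.sub_apply, norm_sub_rev]
  -- This weight turns (1 - αμ)² into 1 - αμ, and α² on the error term into α/μ.
  have hc : 0 < α * μ / (1 - α * μ) := by positivity
  have hc1 : 1 + α * μ / (1 - α * μ) = (1 - α * μ)⁻¹ := by field_simp; ring
  have hc2 : 1 + (α * μ / (1 - α * μ))⁻¹ = (α * μ)⁻¹ := by field_simp; ring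
  have h := norm_add_sq_le_weighted hc a b
  rw [hc1, hc2] at h
  rw [hab]
  have hdev := Stack.normSq_nonneg x.dev
  calc ‖a + b‖ ^ 2 ≤ (1 - α * μ)⁻¹ * ((1 - α * μ) * ‖x.avg - xstar‖) ^ 2
        + (α * μ)⁻¹ * (α ^ 2 * (L ^ 2 / n * x.dev.normSq)) := by
          refine h.trans ?_
          gcongr
    _ = (1 - α * μ) * ‖x.avg - xstar‖ ^ 2 + α * L ^ 2 / (μ * n) * x.dev.normSq := by
          field_simp
    _ ≤ _ := by
          have : 0 ≤ α * L ^ 2 / (μ * n) * x.dev.normSq := by positivity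
          have h2 : 2 * α * L ^ 2 / (μ * n) * x.dev.normSq
              = 2 * (α * L ^ 2 / (μ * n) * x.dev.normSq) := by ring
          linarith

omit hf in
/-- Weighted triangle inequality adapted to a contraction of factor `q`. -/
lemma Stack.normSq_add_le_contraction {q v : ℝ} (hq0 : 0 ≤ q) (hq1 : q < 1) (hv : 0 ≤ v)
    {a : Stack n r} (ha : a.normSq ≤ q * v) (b : Stack n r) :
    (a + b).normSq ≤ (1 + q) / 2 * v + 2 / (1 - q) * b.normSq := by
  have hq : 0 < 1 - q := sub_pos.2 hq1
  -- This weight gives the factor 2q/(1 + q), at most (1 + q)/2 because 4q ≤ (1 + q)².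
  have h := Stack.normSq_add_le_weighted (c := (1 - q) / (1 + q)) (by positivity) a b
  have hc1 : 1 + (1 - q) / (1 + q) = 2 / (1 + q) := by field_simp; ring
  have hc2 : 1 + ((1 - q) / (1 + q))⁻¹ = 2 / (1 - q) := by field_simp; ring
  rw [hc1, hc2] at h
  have h1 : 2 / (1 + q) * a.normSq ≤ (1 + q) / 2 * v := by
    rw [div_mul_eq_mul_div, div_le_iff₀ (by positivity)]
    nlinarith [mul_nonneg (sq_nonneg (1 - q)) hv]
  linarith

omit hf in
lemma normSq_dev_mix_sub_le (hn : 0 < n) (hW : IsCoupling W) (hT : 0 < 1 - mixRad W ^ 2)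
    (x y : Stack n r) :
    ((mix W x).dev - α • y.dev).normSq
      ≤ (1 + mixRad W ^ 2) / 2 * x.dev.normSq
        + 2 * α ^ 2 / (1 - mixRad W ^ 2) * y.dev.normSq := by
  have h := Stack.normSq_add_le_contraction (sq_nonneg _) (by linarith)
    (Stack.normSq_nonneg x.dev) (hW.normSq_dev_mix_le hn x) (-(α • y.dev))
  rw [Stack.normSq_neg, Stack.normSq_smul, ← sub_eq_add_neg] at h
  refine h.trans_eq ?_
  ring

lemma normSq_dev_sIncr_algStep_le (hn : 0 < n) (hW : IsCoupling W) (hT : 0 < 1 - mixRad W ^ 2)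
    (η η' ξ : Stack n r) (z : AlgState n r) :
    (sIncr W f η' (algStep W f α 1 1 η ξ z)).dev.normSq
      ≤ (1 + mixRad W ^ 2) / 2 * (sIncr W f η z).dev.normSq
        + 6 / (1 - mixRad W ^ 2) * (specRad (offDiagPart W) ^ 2 * η'.normSq
          + specRad (offDiagPart W) ^ 2 * η.normSq
          + L ^ 2 * ((algStep W f α 1 1 η ξ z).x - z.x).normSq) := by
  have hWo := offDiagPart_isSymm hW.symmetric
  rw [sIncr_algStep, Stack.dev_add]
  refine (Stack.normSq_add_le_contraction (sq_nonneg _) (by linarith)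
    (Stack.normSq_nonneg (sIncr W f η z).dev) (hW.normSq_dev_mix_le hn _) _).trans ?_
  have h1 := normSq_mix_le hWo η
  have h2 := normSq_mix_le hWo η'
  have h3 := normSq_gradStack_sub_le hf (algStep W f α 1 1 η ξ z).x z.x
  set a := mix (offDiagPart W) η'
  set b := mix (offDiagPart W) η
  set c := gradStack f (algStep W f α 1 1 η ξ z).x - gradStack f z.x
  have h4 : (a - b + c).normSq ≤ 3 * (a.normSq + b.normSq + c.normSq) := by
    have e1 := Stack.normSq_add_le_weighted (c := 1 / 2) (by norm_num) (a - b) c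
    have e2 := Stack.normSq_sub_le a b
    norm_num at e1
    linarith
  have h5 := (Stack.normSq_dev_le hn (a - b + c)).trans h4
  have h6 : 0 < 2 / (1 - mixRad W ^ 2) := by positivity
  have h7 : 6 / (1 - mixRad W ^ 2) = 2 / (1 - mixRad W ^ 2) * 3 := by ring
  rw [h7, mul_assoc (2 / (1 - mixRad W ^ 2))]
  gcongr
  linarith

/-- Split into deviation and average. Mixing fixes averages, so the average part is only -α times
that of y, that is, averaged noise plus average gradient. "Noiseless" refers to ξ alone. -/
lemma normSq_noiseless_increment_le (hn : 0 < n) (hW : IsCoupling W)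
    (hT : 0 < 1 - mixRad W ^ 2) (hL : 0 < L) (hα : 0 < α) (hαL : α * L ≤ 1) {xstar : Vec r}
    (hx : ∀ x, globalObj f xstar ≤ globalObj f x) (η : Stack n r) (z : AlgState n r) :
    (mix W z.x - z.x - α • sIncr W f η z).normSq
      ≤ 10 * z.x.dev.normSq + 2 * α ^ 2 * (sIncr W f η z).dev.normSq
        + 2 * n * α ^ 2 * L ^ 2 * ‖z.x.avg - xstar‖ ^ 2
        + 2 * α ^ 2 * (specRad (offDiagPart W) ^ 2 * η.normSq) := by
  set y := sIncr W f η z with hy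
  have havg : (mix W z.x - z.x - α • y).avg = -(α • y.avg) := by
    rw [Stack.avg_sub, Stack.avg_sub, hW.avg_mix hn, sub_self, zero_sub, Stack.avg_smul]
  have hyavg : y.avg = (mix (offDiagPart W) η).avg + (gradStack f z.x).avg := by
    rw [hy, sIncr, Stack.avg_add, Stack.avg_add, Stack.avg_sub, hW.avg_mix hn, sub_self, zero_add]
  rw [Stack.normSq_eq_dev_add hn, havg, Stack.dev_sub, Stack.dev_sub, Stack.dev_smul, norm_neg,
    norm_smul, mul_pow, Real.norm_eq_abs, sq_abs]
  have h1 := Stack.normSq_sub_le ((mix W z.x).dev - z.x.dev) (α • y.dev)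
  rw [Stack.normSq_smul] at h1
  have h2 := Stack.normSq_sub_le (mix W z.x).dev z.x.dev
  have h3 : (mix W z.x).dev.normSq ≤ z.x.dev.normSq :=
    (hW.normSq_dev_mix_le hn z.x).trans
      (mul_le_of_le_one_left (Stack.normSq_nonneg _) (by linarith))
  have h4 := norm_add_sq_le_weighted one_pos (mix (offDiagPart W) η).avg (gradStack f z.x).avg
  rw [← hyavg, inv_one] at h4
  have h5 := (Stack.card_mul_norm_avg_sq_le hn _).trans
    (normSq_mix_le (offDiagPart_isSymm hW.symmetric) η)
  have h6 := card_mul_norm_avg_gradStack_sq_le hf hn hx z.x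
  have hα2 : 0 ≤ α ^ 2 := sq_nonneg α
  have h7 : n * (α ^ 2 * ‖y.avg‖ ^ 2) ≤ α ^ 2 * (2 * (specRad (offDiagPart W) ^ 2 * η.normSq)
      + 2 * (L ^ 2 * (z.x.dev.normSq + n * ‖z.x.avg - xstar‖ ^ 2))) := by
    rw [mul_left_comm]
    refine mul_le_mul_of_nonneg_left ?_ hα2
    have : (n : ℝ) * ‖y.avg‖ ^ 2 ≤ n * ((1 + 1) * ‖(mix (offDiagPart W) η).avg‖ ^ 2
      + (1 + 1) * ‖(gradStack f z.x).avg‖ ^ 2) := by gcongr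
    linarith
  -- The constant 10 is 8 from the deviation of Wx - x plus 2 from the average gradient.
  have h8 : (α * L) ^ 2 * z.x.dev.normSq ≤ z.x.dev.normSq :=
    mul_le_of_le_one_left (Stack.normSq_nonneg _) (pow_le_one₀ (by positivity) hαL)
  linarith

end Recursion

/-! ### Square integrability and uncorrelatedness of fresh noise. -/

section Noise

variable {n r : ℕ} {Ω : Type*} {m m' : MeasurableSpace Ω} [mΩ : MeasurableSpace Ω] {P : Measure Ω}

/-- A random stacked variable that is square integrable and measurable with respect to `m`. -/
def IsSqIntegrable {n r : ℕ} {Ω : Type*} {m₀ : MeasurableSpace Ω} (m : MeasurableSpace Ω)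
    (P : @Measure Ω m₀) (X : Ω → Stack n r) : Prop :=
  ∀ i, Measurable[m] (fun ω => X ω i) ∧ MemLp (fun ω => X ω i) 2 P

namespace IsSqIntegrable

variable {X Y : Ω → Stack n r}

lemma mono (h : m ≤ m') (hX : IsSqIntegrable m P X) : IsSqIntegrable m' P X :=
  fun i => ⟨(hX i).1.mono h le_rfl, (hX i).2⟩

lemma const [IsFiniteMeasure P] (x : Stack n r) : IsSqIntegrable m P fun _ => x :=
  fun _ => ⟨measurable_const, memLp_const _⟩

lemma add (hX : IsSqIntegrable m P X) (hY : IsSqIntegrable m P Y) :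
    IsSqIntegrable m P fun ω => X ω + Y ω :=
  fun i => ⟨(hX i).1.add (hY i).1, (hX i).2.add (hY i).2⟩

lemma sub (hX : IsSqIntegrable m P X) (hY : IsSqIntegrable m P Y) :
    IsSqIntegrable m P fun ω => X ω - Y ω :=
  fun i => ⟨(hX i).1.sub (hY i).1, (hX i).2.sub (hY i).2⟩

lemma smul (c : ℝ) (hX : IsSqIntegrable m P X) : IsSqIntegrable m P fun ω => c • X ω :=
  fun i => ⟨(hX i).1.const_smul c, (hX i).2.const_smul c⟩

lemma mix (M : Matrix (Fin n) (Fin n) ℝ) (hX : IsSqIntegrable m P X) :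
    IsSqIntegrable m P fun ω => mix M (X ω) :=
  fun i => ⟨Finset.measurable_fun_sum Finset.univ fun j _ => (hX j).1.const_smul (M i j),
    memLp_finsetSum Finset.univ fun j _ => (hX j).2.const_smul (M i j)⟩

lemma dev (hX : IsSqIntegrable m P X) : IsSqIntegrable m P fun ω => (X ω).dev := hX.mix _

lemma avg (hX : IsSqIntegrable m P X) : IsSqIntegrable m P fun ω => (fun _ => (X ω).avg : Stack n r) := by
  have := hX.mix (avgMatrix n)
  intro i
  simpa only [mix_avgMatrix] using this i

lemma gradStack [IsFiniteMeasure P] {μ L : ℝ} {f : Fin n → Vec r → ℝ}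
    (hf : ∀ i, IsStronglyConvexSmooth μ L (f i)) (hL : 0 ≤ L) (hX : IsSqIntegrable m P X) :
    IsSqIntegrable m P fun ω => gradStack f (X ω) := by
  intro i
  have hlip : LipschitzWith ⟨L, hL⟩ (gradient (f i)) :=
    LipschitzWith.of_dist_le_mul fun x y => by
      rw [dist_eq_norm, dist_eq_norm]; exact (hf i).lipschitz x y
  refine ⟨hlip.continuous.measurable.comp (hX i).1, ?_⟩
  -- Composition with a Lipschitz map preserves L² when the map fixes 0, hence the shift.
  have hlip' : LipschitzWith ⟨L, hL⟩ fun x => gradient (f i) x - gradient (f i) 0 :=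
    LipschitzWith.of_dist_le_mul fun x y => by
      rw [dist_sub_right]; exact hlip.dist_le_mul x y
  have h1 := (hlip'.comp_memLp (sub_self _) (hX i).2).add (memLp_const (gradient (f i) 0))
  refine h1.ae_eq (Eventually.of_forall fun ω => ?_)
  simp [_root_.gradStack]

lemma integrable_row (hX : IsSqIntegrable m P X) (i : Fin n) :
    Integrable (fun ω => ‖X ω i‖ ^ 2) P :=
  (hX i).2.integrable_norm_pow two_ne_zero

lemma integrable_normSq (hX : IsSqIntegrable m P X) : Integrable (fun ω => (X ω).normSq) P :=
  integrable_finsetSum _ fun i _ => hX.integrable_row i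

end IsSqIntegrable

lemma MeasureTheory.MemLp.integrable_inner_two {E : Type*} [NormedAddCommGroup E]
    [InnerProductSpace ℝ E] {X Y : Ω → E} (hX : MemLp X 2 P) (hY : MemLp Y 2 P) :
    Integrable (fun ω => inner ℝ (X ω) (Y ω)) P := by
  refine ((hX.integrable_norm_pow two_ne_zero).add (hY.integrable_norm_pow two_ne_zero)).mono'
    (hX.1.inner hY.1) (Eventually.of_forall fun ω => ?_)
  simp only [Pi.add_apply]
  have h1 := norm_inner_le_norm (𝕜 := ℝ) (X ω) (Y ω)
  nlinarith [sq_nonneg (‖X ω‖ - ‖Y ω‖), norm_nonneg (X ω), norm_nonneg (Y ω)]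

/-- Pythagoras for uncorrelated random vectors. -/
lemma integral_norm_add_sq_of_uncorrelated {E : Type*} [NormedAddCommGroup E]
    [InnerProductSpace ℝ E] {X Y : Ω → E} (hX : MemLp X 2 P) (hY : MemLp Y 2 P)
    (h : ∫ ω, inner ℝ (X ω) (Y ω) ∂P = 0) :
    ∫ ω, ‖X ω + Y ω‖ ^ 2 ∂P = ∫ ω, ‖X ω‖ ^ 2 ∂P + ∫ ω, ‖Y ω‖ ^ 2 ∂P := by
  have hi := (hX.integrable_inner_two hY).const_mul 2
  have hX2 := hX.integrable_norm_pow two_ne_zero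
  have hY2 := hY.integrable_norm_pow two_ne_zero
  calc ∫ ω, ‖X ω + Y ω‖ ^ 2 ∂P
      = ∫ ω, (‖X ω‖ ^ 2 + 2 * inner ℝ (X ω) (Y ω)) + ‖Y ω‖ ^ 2 ∂P := by
        simp only [norm_add_sq_real]
    _ = _ := by
        rw [integral_add (f := fun ω => ‖X ω‖ ^ 2 + 2 * inner ℝ (X ω) (Y ω)) (hX2.add hi) hY2,
          integral_add hX2 hi, integral_const_mul, h]
        ring

/-- The scalar entries of the two noise sequences. -/
def noiseEntry (η ξ : ℕ → Ω → Stack n r) :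
    (ℕ × Fin n × Fin r) ⊕ (ℕ × Fin n × Fin r) → Ω → ℝ :=
  Sum.elim (fun e ω => η e.1 ω e.2.1 e.2.2) (fun e ω => ξ e.1 ω e.2.1 e.2.2)

/-- The indices of the entries of `η_l`, `l < a`, and of `ξ_l`, `l < b`. -/
def pastEntries (n r a b : ℕ) : Set ((ℕ × Fin n × Fin r) ⊕ (ℕ × Fin n × Fin r)) :=
  {e | Sum.elim (fun e => e.1 < a) (fun e => e.1 < b) e}

/-- The σ-algebra generated by the entries of `η_l`, `l < a`, and of `ξ_l`, `l < b`. -/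
@[reducible]
def noiseSigma (η ξ : ℕ → Ω → Stack n r) (a b : ℕ) : MeasurableSpace Ω :=
  ⨆ e ∈ pastEntries n r a b, MeasurableSpace.comap (noiseEntry η ξ e) inferInstance

omit mΩ in
lemma noiseSigma_mono (η ξ : ℕ → Ω → Stack n r) {a a' b b' : ℕ} (ha : a ≤ a') (hb : b ≤ b') :
    noiseSigma η ξ a b ≤ noiseSigma η ξ a' b' := by
  refine biSup_mono fun e he => ?_
  rcases e with e | e
  · exact lt_of_lt_of_le (show e.1 < a from he) ha
  · exact lt_of_lt_of_le (show e.1 < b from he) hb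

namespace IsNoise

variable {ση σξ : ℝ} {η ξ : ℕ → Ω → Stack n r} (h : IsNoise P ση σξ η ξ)
include h

lemma measurable_noiseEntry (e) : Measurable (noiseEntry η ξ e) := by
  rcases e with e | e
  · exact h.measurable_η _ _ _
  · exact h.measurable_ξ _ _ _

lemma noiseSigma_le (a b : ℕ) : noiseSigma η ξ a b ≤ mΩ :=
  iSup₂_le fun e _ => (h.measurable_noiseEntry e).comap_le

lemma isSqIntegrable_η {k a b : ℕ} (hk : k < a) :
    IsSqIntegrable (noiseSigma η ξ a b) P (η k) := by
  intro i
  refine ⟨?_, MemLp.of_eval_piLp fun c => h.memLp_η k i c⟩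
  refine (WithLp.measurable_toLp 2 (Fin r → ℝ)).comp
    (@measurable_pi_iff _ _ _ (noiseSigma η ξ a b) _ (fun ω => (η k ω i).ofLp) |>.2 fun c => ?_)
  refine (comap_measurable (noiseEntry η ξ (Sum.inl (k, i, c)))).mono ?_ le_rfl
  exact le_iSup₂_of_le (Sum.inl (k, i, c)) hk le_rfl

lemma isSqIntegrable_ξ {k a b : ℕ} (hk : k < b) :
    IsSqIntegrable (noiseSigma η ξ a b) P (ξ k) := by
  intro i
  refine ⟨?_, MemLp.of_eval_piLp fun c => h.memLp_ξ k i c⟩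
  refine (WithLp.measurable_toLp 2 (Fin r → ℝ)).comp
    (@measurable_pi_iff _ _ _ (noiseSigma η ξ a b) _ (fun ω => (ξ k ω i).ofLp) |>.2 fun c => ?_)
  refine (comap_measurable (noiseEntry η ξ (Sum.inr (k, i, c)))).mono ?_ le_rfl
  exact le_iSup₂_of_le (Sum.inr (k, i, c)) hk le_rfl

/-- An entry of the noise is uncorrelated with every variable generated by other entries. -/
lemma integral_mul_noiseEntry_eq_zero {a b : ℕ} {e : (ℕ × Fin n × Fin r) ⊕ (ℕ × Fin n × Fin r)}
    (he : e ∉ pastEntries n r a b)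
    {Z : Ω → ℝ} (hZ : Measurable[noiseSigma η ξ a b] Z) :
    ∫ ω, Z ω * noiseEntry η ξ e ω ∂P = 0 := by
  have hindep := indep_iSup_of_disjoint (fun e => (h.measurable_noiseEntry e).comap_le)
    h.indep.iIndep (S := pastEntries n r a b) (T := {e})
    (Set.disjoint_singleton_right.2 he)
  rw [iSup_singleton] at hindep
  have hf : IndepFun Z (noiseEntry η ξ e) P :=
    indep_of_indep_of_le_left hindep hZ.comap_le
  rw [hf.integral_fun_mul_eq_mul_integral (hZ.mono (h.noiseSigma_le a b) le_rfl).aestronglyMeasurable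
    (h.measurable_noiseEntry e).aestronglyMeasurable]
  have h0 : ∫ ω, noiseEntry η ξ e ω ∂P = 0 := by
    rcases e with e | e
    · exact h.mean_η _ _ _
    · exact h.mean_ξ _ _ _
  rw [h0, mul_zero]

/-- In coordinates, each term is a past variable times one centered fresh entry. Stating freshness
through the entries lets η and ξ share the argument. -/
lemma integral_inner_mix_eq_zero_of_entries {a b : ℕ} {N : Ω → Stack n r}
    (hN : ∀ j, MemLp (fun ω => N ω j) 2 P)
    (hNe : ∀ j c, ∃ e : (ℕ × Fin n × Fin r) ⊕ (ℕ × Fin n × Fin r),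
      e ∉ pastEntries n r a b ∧
        ∀ ω, N ω j c = noiseEntry η ξ e ω)
    {Z : Ω → Vec r} (hZm : Measurable[noiseSigma η ξ a b] Z) (hZ : MemLp Z 2 P)
    (M : Matrix (Fin n) (Fin n) ℝ) (i : Fin n) :
    ∫ ω, inner ℝ (Z ω) (mix M (N ω) i) ∂P = 0 := by
  have hrow : ∀ j, ∫ ω, inner ℝ (Z ω) (N ω j) ∂P = 0 := by
    intro j
    simp only [PiLp.inner_apply]
    rw [integral_finsetSum]
    · refine Finset.sum_eq_zero fun c _ => ?_
      obtain ⟨e, he, hee⟩ := hNe j c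
      have hZc : Measurable[noiseSigma η ξ a b] fun ω => Z ω c :=
        (EuclideanSpace.proj (𝕜 := ℝ) c).continuous.measurable.comp hZm
      rw [← h.integral_mul_noiseEntry_eq_zero he hZc]
      refine integral_congr_ae (Eventually.of_forall fun ω => ?_)
      simp [hee, mul_comm]
    · intro c _
      exact (hZ.eval_piLp c).integrable_inner_two ((hN j).eval_piLp c)
  simp only [mix_apply, inner_sum, real_inner_smul_right]
  rw [integral_finsetSum _ fun j _ => (hZ.integrable_inner_two (hN j)).const_mul _]
  refine Finset.sum_eq_zero fun j _ => ?_
  rw [integral_const_mul, hrow, mul_zero]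

lemma integral_inner_mix_η_eq_zero {k a b : ℕ} (hk : a ≤ k)
    {Z : Ω → Vec r} (hZm : Measurable[noiseSigma η ξ a b] Z) (hZ : MemLp Z 2 P)
    (M : Matrix (Fin n) (Fin n) ℝ) (i : Fin n) :
    ∫ ω, inner ℝ (Z ω) (mix M (η k ω) i) ∂P = 0 :=
  h.integral_inner_mix_eq_zero_of_entries
    (fun j => (h.isSqIntegrable_η (b := b) (Nat.lt_succ_self k) j).2)
    (fun j c => ⟨Sum.inl (k, j, c), not_lt.2 hk, fun _ => rfl⟩) hZm hZ M i

lemma integral_inner_mix_ξ_eq_zero {k a b : ℕ} (hk : b ≤ k)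
    {Z : Ω → Vec r} (hZm : Measurable[noiseSigma η ξ a b] Z) (hZ : MemLp Z 2 P)
    (M : Matrix (Fin n) (Fin n) ℝ) (i : Fin n) :
    ∫ ω, inner ℝ (Z ω) (mix M (ξ k ω) i) ∂P = 0 :=
  h.integral_inner_mix_eq_zero_of_entries
    (fun j => (h.isSqIntegrable_ξ (a := a) (Nat.lt_succ_self k) j).2)
    (fun j c => ⟨Sum.inr (k, j, c), not_lt.2 hk, fun _ => rfl⟩) hZm hZ M i

/-- Pythagoras for a past variable and a mixed noise `ξ_k`. -/
lemma integral_normSq_add_mix_ξ {k a b : ℕ} (hk : b ≤ k) {Z : Ω → Stack n r}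
    (hZ : IsSqIntegrable (noiseSigma η ξ a b) P Z) (M : Matrix (Fin n) (Fin n) ℝ) :
    ∫ ω, (Z ω + mix M (ξ k ω)).normSq ∂P
      = ∫ ω, (Z ω).normSq ∂P + ∫ ω, (mix M (ξ k ω)).normSq ∂P := by
  have hN := (h.isSqIntegrable_ξ (a := a) (Nat.lt_succ_self k)).mix M
  simp only [Stack.normSq]
  rw [integral_finsetSum _ fun i _ => hZ.integrable_row i,
    integral_finsetSum _ fun i _ => hN.integrable_row i,
    integral_finsetSum _ fun i _ =>
      ((hZ.mono (noiseSigma_mono η ξ le_rfl (by omega))).add hN).integrable_row i,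
    ← Finset.sum_add_distrib]
  refine Finset.sum_congr rfl fun i _ => ?_
  exact integral_norm_add_sq_of_uncorrelated (hZ i).2 (hN i).2
    (h.integral_inner_mix_ξ_eq_zero hk (hZ i).1 (hZ i).2 M i)

lemma integral_normSq_mix_ξ_le {M : Matrix (Fin n) (Fin n) ℝ} (hM : M.IsSymm) (k : ℕ) :
    ∫ ω, (mix M (ξ k ω)).normSq ∂P ≤ specRad M ^ 2 * σξ ^ 2 := by
  have hN := h.isSqIntegrable_ξ (a := 0) (Nat.lt_succ_self k)
  calc ∫ ω, (mix M (ξ k ω)).normSq ∂P ≤ ∫ ω, specRad M ^ 2 * (ξ k ω).normSq ∂P :=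
        integral_mono (hN.mix M).integrable_normSq (hN.integrable_normSq.const_mul _)
          fun ω => normSq_mix_le hM _
    _ ≤ specRad M ^ 2 * σξ ^ 2 := by
        rw [integral_const_mul]
        exact mul_le_mul_of_nonneg_left (h.variance_ξ k) (sq_nonneg _)

lemma integral_normSq_mix_η_le {M : Matrix (Fin n) (Fin n) ℝ} (hM : M.IsSymm) (k : ℕ) :
    ∫ ω, (mix M (η k ω)).normSq ∂P ≤ specRad M ^ 2 * ση ^ 2 := by
  have hN := h.isSqIntegrable_η (b := 0) (Nat.lt_succ_self k)
  calc ∫ ω, (mix M (η k ω)).normSq ∂P ≤ ∫ ω, specRad M ^ 2 * (η k ω).normSq ∂P :=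
        integral_mono (hN.mix M).integrable_normSq (hN.integrable_normSq.const_mul _)
          fun ω => normSq_mix_le hM _
    _ ≤ specRad M ^ 2 * ση ^ 2 := by
        rw [integral_const_mul]
        exact mul_le_mul_of_nonneg_left (h.variance_η k) (sq_nonneg _)

end IsNoise

end Noise

/-! ### The three mean square recursions. -/

section MeanSquare

variable {n r : ℕ} {μ L α ση σξ : ℝ} {f : Fin n → Vec r → ℝ} {W : Matrix (Fin n) (Fin n) ℝ}
  {Ω : Type*} {m : MeasurableSpace Ω} [MeasurableSpace Ω] {P : Measure Ω} [IsProbabilityMeasure P]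
  {η ξ : ℕ → Ω → Stack n r} {z₀ : AlgState n r} {xstar : Vec r}

/-- The random iterates of the algorithm with unit step parameters. -/
noncomputable def iterate (W : Matrix (Fin n) (Fin n) ℝ) (f : Fin n → Vec r → ℝ) (α : ℝ)
    (η ξ : ℕ → Ω → Stack n r) (z₀ : AlgState n r) (k : ℕ) (ω : Ω) : AlgState n r :=
  algRun W f α (fun _ => 1) (fun _ => 1) (fun l => η l ω) (fun l => ξ l ω) z₀ k

/-- The increment of `s` along the random iterates. -/
noncomputable def tracker (W : Matrix (Fin n) (Fin n) ℝ) (f : Fin n → Vec r → ℝ) (α : ℝ)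
    (η ξ : ℕ → Ω → Stack n r) (z₀ : AlgState n r) (k : ℕ) (ω : Ω) : Stack n r :=
  sIncr W f (η k ω) (iterate W f α η ξ z₀ k ω)

omit [MeasurableSpace Ω] in
lemma iterate_succ (k : ℕ) (ω : Ω) :
    iterate W f α η ξ z₀ (k + 1) ω
      = algStep W f α 1 1 (η k ω) (ξ k ω) (iterate W f α η ξ z₀ k ω) := rfl

omit [MeasurableSpace Ω] in
lemma iterate_succ_x (k : ℕ) (ω : Ω) :
    (iterate W f α η ξ z₀ (k + 1) ω).x = mix W (iterate W f α η ξ z₀ k ω).x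
      + mix (offDiagPart W) (ξ k ω) - α • tracker W f α η ξ z₀ k ω :=
  algStep_x _ _ _

lemma isSqIntegrable_sIncr (hf : ∀ i, IsStronglyConvexSmooth μ L (f i))
    (hL : 0 ≤ L) {e : Ω → Stack n r} {z : Ω → AlgState n r} (he : IsSqIntegrable m P e)
    (hs : IsSqIntegrable m P fun ω => (z ω).s) (hx : IsSqIntegrable m P fun ω => (z ω).x) :
    IsSqIntegrable m P fun ω => sIncr W f (e ω) (z ω) :=
  (((hs.mix W).sub hs).add (he.mix _)).add (hx.gradStack hf hL)

lemma isSqIntegrable_iterate (hf : ∀ i, IsStronglyConvexSmooth μ L (f i)) (hL : 0 ≤ L)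
    (h : IsNoise P ση σξ η ξ) (k : ℕ) :
    IsSqIntegrable (noiseSigma η ξ k k) P (fun ω => (iterate W f α η ξ z₀ k ω).s) ∧
    IsSqIntegrable (noiseSigma η ξ k k) P (fun ω => (iterate W f α η ξ z₀ k ω).x) := by
  induction k with
  | zero => exact ⟨IsSqIntegrable.const z₀.s, IsSqIntegrable.const z₀.x⟩
  | succ k ih =>
    have hle := noiseSigma_mono η ξ k.le_succ k.le_succ
    have hs := ih.1.mono hle
    have hx := ih.2.mono hle
    have hη : IsSqIntegrable (noiseSigma η ξ (k + 1) (k + 1)) P (η k) :=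
      h.isSqIntegrable_η k.lt_succ_self
    have hξ : IsSqIntegrable (noiseSigma η ξ (k + 1) (k + 1)) P (ξ k) :=
      h.isSqIntegrable_ξ k.lt_succ_self
    have hy := isSqIntegrable_sIncr (W := W) hf hL hη hs hx
    simp only [iterate_succ, algStep_s, algStep_x]
    exact ⟨hs.add hy, ((hx.mix W).add (hξ.mix _)).sub (hy.smul α)⟩

/-- The increment contains η_k but not ξ_k, hence the unequal indices; ξ_k therefore remains fresh
relative to it. -/
lemma isSqIntegrable_tracker (hf : ∀ i, IsStronglyConvexSmooth μ L (f i)) (hL : 0 ≤ L)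
    (h : IsNoise P ση σξ η ξ) (k : ℕ) :
    IsSqIntegrable (noiseSigma η ξ (k + 1) k) P (tracker W f α η ξ z₀ k) := by
  have ih := isSqIntegrable_iterate (W := W) (α := α) (z₀ := z₀) hf hL h k
  have hle := noiseSigma_mono η ξ k.le_succ (le_refl k)
  exact isSqIntegrable_sIncr hf hL (h.isSqIntegrable_η k.lt_succ_self) (ih.1.mono hle)
    (ih.2.mono hle)

lemma integrable_optErr (hf : ∀ i, IsStronglyConvexSmooth μ L (f i)) (hL : 0 ≤ L)
    (hn : 0 < n) (h : IsNoise P ση σξ η ξ) (k : ℕ) :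
    Integrable (fun ω => optErr xstar (iterate W f α η ξ z₀ k ω).x) P :=
  ((isSqIntegrable_iterate (W := W) (α := α) (z₀ := z₀) hf hL h k).2.avg.sub
    (IsSqIntegrable.const fun _ => xstar)).integrable_row ⟨0, hn⟩

lemma integrable_consErr (hf : ∀ i, IsStronglyConvexSmooth μ L (f i)) (hL : 0 ≤ L)
    (h : IsNoise P ση σξ η ξ) (k : ℕ) :
    Integrable (fun ω => consErr (iterate W f α η ξ z₀ k ω).x) P := by
  simp only [consErr_eq]
  exact (isSqIntegrable_iterate (W := W) (α := α) (z₀ := z₀) hf hL h k).2.dev.integrable_normSq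

variable (hf : ∀ i, IsStronglyConvexSmooth μ L (f i)) (hW : IsCoupling W)
  (h : IsNoise P ση σξ η ξ)
include hf hW h

/-- Both η_k and ξ_k are fresh relative to x_k, so the averaged step splits into a noiseless part
and a pure noise part. -/
lemma integral_optErr_succ_le (hn : 2 ≤ n) (hμ : 0 < μ) (hL : 0 < L) (hα : 0 < α)
    (hαL : α * (μ + L) < 1) (hx : ∀ x, globalObj f xstar ≤ globalObj f x) (k : ℕ) :
    ∫ ω, optErr xstar (iterate W f α η ξ z₀ (k + 1) ω).x ∂P
      ≤ (1 - α * μ) * ∫ ω, optErr xstar (iterate W f α η ξ z₀ k ω).x ∂P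
        + 2 * α * L ^ 2 / (μ * n) * ∫ ω, consErr (iterate W f α η ξ z₀ k ω).x ∂P
        + specRad (offDiagPart W) ^ 2 * (α ^ 2 * ση ^ 2 + σξ ^ 2) := by
  have hn0 : 0 < n := by omega
  have hWo := offDiagPart_isSymm hW.symmetric
  set X : Ω → Stack n r := fun ω => (iterate W f α η ξ z₀ k ω).x with hX
  have hXi : IsSqIntegrable (noiseSigma η ξ k k) P X := (isSqIntegrable_iterate hf hL.le h k).2
  let i₀ : Fin n := ⟨0, hn0⟩
  let Z : Ω → Vec r := fun ω => (X ω).avg - xstar - α • (gradStack f (X ω)).avg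
  have hZi : IsSqIntegrable (noiseSigma η ξ k k) P fun ω => (fun _ => Z ω : Stack n r) :=
    (hXi.avg.sub (IsSqIntegrable.const fun _ => xstar)).sub
      ((hXi.gradStack hf hL.le).avg.smul α)
  obtain ⟨hZm, hZ⟩ := hZi i₀
  let Nξ : Ω → Vec r := fun ω => (mix (offDiagPart W) (ξ k ω)).avg
  let Nη : Ω → Vec r := fun ω => (mix (offDiagPart W) (η k ω)).avg
  have hNξe : ∀ ω, Nξ ω = mix (avgMatrix n * offDiagPart W) (ξ k ω) i₀ := fun ω => by
    rw [mix_mul, mix_avgMatrix]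
  have hNηe : ∀ ω, Nη ω = mix (avgMatrix n * offDiagPart W) (η k ω) i₀ := fun ω => by
    rw [mix_mul, mix_avgMatrix]
  have hξi := (h.isSqIntegrable_ξ (a := 0) k.lt_succ_self).mix (offDiagPart W)
  have hηi := (h.isSqIntegrable_η (b := 0) k.lt_succ_self).mix (offDiagPart W)
  have hNξ : MemLp Nξ 2 P := (hξi.avg i₀).2
  have hNη : MemLp Nη 2 P := (hηi.avg i₀).2
  have hN : MemLp (fun ω => Nξ ω - α • Nη ω) 2 P := hNξ.sub (hNη.const_smul α)
  have hξ0 : ∫ ω, inner ℝ (Z ω) (Nξ ω) ∂P = 0 := by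
    simp only [hNξe]
    exact h.integral_inner_mix_ξ_eq_zero le_rfl hZm hZ _ _
  have hη0 : ∫ ω, inner ℝ (Z ω) (Nη ω) ∂P = 0 := by
    simp only [hNηe]
    exact h.integral_inner_mix_η_eq_zero le_rfl hZm hZ _ _
  have hcross : ∫ ω, inner ℝ (Z ω) (Nξ ω - α • Nη ω) ∂P = 0 := by
    simp only [inner_sub_right, real_inner_smul_right]
    rw [integral_sub (hZ.integrable_inner_two hNξ) ((hZ.integrable_inner_two hNη).const_mul α),
      integral_const_mul, hξ0, hη0, mul_zero, sub_zero]
  have hstep : ∀ ω, optErr xstar (iterate W f α η ξ z₀ (k + 1) ω).x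
      = ‖Z ω + (Nξ ω - α • Nη ω)‖ ^ 2 := by
    intro ω
    rw [optErr, iterate_succ_x, Stack.avg_sub, Stack.avg_add, Stack.avg_smul, tracker, sIncr,
      Stack.avg_add, Stack.avg_add, Stack.avg_sub, hW.avg_mix hn0, hW.avg_mix hn0, sub_self,
      zero_add]
    congr 2
    simp only [Z, Nξ, Nη, hX]
    module
  have hNle : ∫ ω, ‖Nξ ω - α • Nη ω‖ ^ 2 ∂P
      ≤ specRad (offDiagPart W) ^ 2 * (α ^ 2 * ση ^ 2 + σξ ^ 2) := by
    -- Splitting the two noises costs a factor 2, repaid by averaging over n ≥ 2 rows.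
    have hpt : ∀ ω, ‖Nξ ω - α • Nη ω‖ ^ 2 ≤ (mix (offDiagPart W) (ξ k ω)).normSq
        + α ^ 2 * (mix (offDiagPart W) (η k ω)).normSq := by
      intro ω
      have h1 := norm_add_sq_le_weighted one_pos (Nξ ω) (-(α • Nη ω))
      rw [norm_neg, norm_smul, mul_pow, Real.norm_eq_abs, sq_abs, ← sub_eq_add_neg,
        inv_one] at h1
      have hn2 : (2 : ℝ) ≤ n := by exact_mod_cast hn
      have h2 : 2 * ‖Nξ ω‖ ^ 2 ≤ (mix (offDiagPart W) (ξ k ω)).normSq :=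
        (mul_le_mul_of_nonneg_right hn2 (sq_nonneg _)).trans
          (Stack.card_mul_norm_avg_sq_le hn0 _)
      have h3 : 2 * ‖Nη ω‖ ^ 2 ≤ (mix (offDiagPart W) (η k ω)).normSq :=
        (mul_le_mul_of_nonneg_right hn2 (sq_nonneg _)).trans
          (Stack.card_mul_norm_avg_sq_le hn0 _)
      have h4 := mul_le_mul_of_nonneg_left h3 (sq_nonneg α)
      linarith
    have h1 := integral_mono (hN.integrable_norm_pow two_ne_zero)
      (hξi.integrable_normSq.add (hηi.integrable_normSq.const_mul (α ^ 2))) hpt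
    rw [integral_add' hξi.integrable_normSq (hηi.integrable_normSq.const_mul _),
      integral_const_mul] at h1
    have h2 := h.integral_normSq_mix_ξ_le hWo k
    have h3 := mul_le_mul_of_nonneg_left (h.integral_normSq_mix_η_le hWo k) (sq_nonneg α)
    linarith
  have hU := integrable_optErr (W := W) (α := α) (z₀ := z₀) (xstar := xstar) hf hL.le hn0 h k
  have hV := integrable_consErr (W := W) (α := α) (z₀ := z₀) hf hL.le h k
  have hZle : ∫ ω, ‖Z ω‖ ^ 2 ∂P
      ≤ (1 - α * μ) * ∫ ω, optErr xstar (X ω) ∂P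
        + 2 * α * L ^ 2 / (μ * n) * ∫ ω, consErr (X ω) ∂P := by
    rw [← integral_const_mul, ← integral_const_mul,
      ← integral_add (hU.const_mul _) (hV.const_mul _)]
    refine integral_mono (hZ.integrable_norm_pow two_ne_zero)
      ((hU.const_mul _).add (hV.const_mul _)) fun ω => ?_
    simp only [consErr_eq, optErr]
    exact norm_avg_step_sq_le hf hn0 hμ hL hα hαL hx (X ω)
  simp only [hstep]
  rw [integral_norm_add_sq_of_uncorrelated hZ hN hcross]
  exact add_le_add hZle hNle

lemma integral_consErr_succ_le (hn : 0 < n) (hL : 0 < L) (hT : 0 < 1 - mixRad W ^ 2) (k : ℕ) :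
    ∫ ω, consErr (iterate W f α η ξ z₀ (k + 1) ω).x ∂P
      ≤ (1 + mixRad W ^ 2) / 2 * ∫ ω, consErr (iterate W f α η ξ z₀ k ω).x ∂P
        + 2 * α ^ 2 / (1 - mixRad W ^ 2) * ∫ ω, (tracker W f α η ξ z₀ k ω).dev.normSq ∂P
        + specRad (offDiagPart W) ^ 2 * σξ ^ 2 := by
  have hWo := offDiagPart_isSymm hW.symmetric
  set X : Ω → Stack n r := fun ω => (iterate W f α η ξ z₀ k ω).x with hX
  set Y : Ω → Stack n r := tracker W f α η ξ z₀ k with hY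
  have hXi : IsSqIntegrable (noiseSigma η ξ (k + 1) k) P X :=
    (isSqIntegrable_iterate hf hL.le h k).2.mono (noiseSigma_mono η ξ k.le_succ le_rfl)
  have hYi : IsSqIntegrable (noiseSigma η ξ (k + 1) k) P Y := isSqIntegrable_tracker hf hL.le h k
  have hZi := (hXi.mix W).dev.sub (hYi.dev.smul α)
  have hstep : ∀ ω, consErr (iterate W f α η ξ z₀ (k + 1) ω).x
      = (((mix W (X ω)).dev - α • (Y ω).dev)
        + mix ((1 - avgMatrix n) * offDiagPart W) (ξ k ω)).normSq := by
    intro ω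
    rw [consErr_eq, iterate_succ_x, Stack.dev_sub, Stack.dev_add, Stack.dev_smul, mix_mul]
    congr 1
    change _ = (mix W (X ω)).dev - α • (Y ω).dev + (mix (offDiagPart W) (ξ k ω)).dev
    simp only [hX, hY]
    abel
  have hξi := (h.isSqIntegrable_ξ (a := 0) k.lt_succ_self).mix (offDiagPart W)
  have hNle : ∫ ω, (mix ((1 - avgMatrix n) * offDiagPart W) (ξ k ω)).normSq ∂P
      ≤ specRad (offDiagPart W) ^ 2 * σξ ^ 2 := by
    refine le_trans ?_ (h.integral_normSq_mix_ξ_le hWo k)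
    simp only [mix_mul]
    exact integral_mono hξi.dev.integrable_normSq hξi.integrable_normSq
      fun ω => Stack.normSq_dev_le hn _
  simp only [hstep]
  rw [h.integral_normSq_add_mix_ξ le_rfl hZi]
  refine add_le_add ?_ hNle
  have hV : Integrable (fun ω => consErr (X ω)) P := integrable_consErr hf hL.le h k
  have hS := hYi.dev.integrable_normSq
  rw [← integral_const_mul, ← integral_const_mul,
    ← integral_add (hV.const_mul _) (hS.const_mul _)]
  refine integral_mono hZi.integrable_normSq ((hV.const_mul _).add (hS.const_mul _)) fun ω => ?_
  simp only [consErr_eq]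
  exact normSq_dev_mix_sub_le hn hW hT (X ω) (Y ω)

/-- Only ξ_k is split off by Pythagoras: η_k is part of the increment of s, so it stays in the
pathwise bound. -/
lemma integral_normSq_increment_le (hn : 0 < n) (hL : 0 < L) (hα : 0 < α) (hαL : α * L ≤ 1)
    (hT : 0 < 1 - mixRad W ^ 2) (hx : ∀ x, globalObj f xstar ≤ globalObj f x) (k : ℕ) :
    ∫ ω, ((iterate W f α η ξ z₀ (k + 1) ω).x - (iterate W f α η ξ z₀ k ω).x).normSq ∂P
      ≤ 10 * ∫ ω, consErr (iterate W f α η ξ z₀ k ω).x ∂P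
        + 2 * α ^ 2 * ∫ ω, (tracker W f α η ξ z₀ k ω).dev.normSq ∂P
        + 2 * n * α ^ 2 * L ^ 2 * ∫ ω, optErr xstar (iterate W f α η ξ z₀ k ω).x ∂P
        + 2 * α ^ 2 * (specRad (offDiagPart W) ^ 2 * ση ^ 2)
        + specRad (offDiagPart W) ^ 2 * σξ ^ 2 := by
  have hWo := offDiagPart_isSymm hW.symmetric
  set X : Ω → Stack n r := fun ω => (iterate W f α η ξ z₀ k ω).x with hX
  set Y : Ω → Stack n r := tracker W f α η ξ z₀ k with hY
  have hXi : IsSqIntegrable (noiseSigma η ξ (k + 1) k) P X :=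
    (isSqIntegrable_iterate hf hL.le h k).2.mono (noiseSigma_mono η ξ k.le_succ le_rfl)
  have hYi : IsSqIntegrable (noiseSigma η ξ (k + 1) k) P Y := isSqIntegrable_tracker hf hL.le h k
  have hηi : IsSqIntegrable (noiseSigma η ξ (k + 1) k) P (η k) :=
    h.isSqIntegrable_η k.lt_succ_self
  have hZi := ((hXi.mix W).sub hXi).sub (hYi.smul α)
  have hstep : ∀ ω, (iterate W f α η ξ z₀ (k + 1) ω).x - (iterate W f α η ξ z₀ k ω).x
      = (mix W (X ω) - X ω - α • Y ω) + mix (offDiagPart W) (ξ k ω) := by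
    intro ω
    rw [iterate_succ_x]
    simp only [hX, hY]
    abel
  simp only [hstep]
  rw [h.integral_normSq_add_mix_ξ le_rfl hZi]
  refine add_le_add ?_ (h.integral_normSq_mix_ξ_le hWo k)
  have hV : Integrable (fun ω => consErr (X ω)) P := integrable_consErr hf hL.le h k
  have hU : Integrable (fun ω => optErr xstar (X ω)) P := integrable_optErr hf hL.le hn h k
  have hS := hYi.dev.integrable_normSq
  have hE := hηi.integrable_normSq
  have hvar : 2 * α ^ 2 * (specRad (offDiagPart W) ^ 2 * ∫ ω, (η k ω).normSq ∂P)
      ≤ 2 * α ^ 2 * (specRad (offDiagPart W) ^ 2 * ση ^ 2) := by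
    have := h.variance_η k
    gcongr
  refine le_trans ?_ (add_le_add_right hvar _)
  have i1 := hV.const_mul 10
  have i2 := hS.const_mul (2 * α ^ 2)
  have i3 := hU.const_mul (2 * n * α ^ 2 * L ^ 2)
  have i4 := (hE.const_mul (specRad (offDiagPart W) ^ 2)).const_mul (2 * α ^ 2)
  rw [← integral_const_mul, ← integral_const_mul, ← integral_const_mul, ← integral_const_mul,
    ← integral_const_mul, ← integral_add i1 i2,
    ← integral_add (f := fun ω => _ + _) (i1.add i2) i3,
    ← integral_add (f := fun ω => _ + _) ((i1.add i2).add i3) i4]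
  refine integral_mono hZi.integrable_normSq (((i1.add i2).add i3).add i4) fun ω => ?_
  simp only [consErr_eq, optErr]
  exact normSq_noiseless_increment_le hf hn hW hT hL hα hαL hx (η k ω)
    (iterate W f α η ξ z₀ k ω)

/-- Integrates the pathwise bound; the two η variances are kept without using independence, and the
movement of x comes from `integral_normSq_increment_le`. -/
lemma integral_tracker_succ_le (hn : 0 < n) (hL : 0 < L) (hα : 0 < α) (hαL : α * L ≤ 1)
    (hT : 0 < 1 - mixRad W ^ 2) (hx : ∀ x, globalObj f xstar ≤ globalObj f x) (k : ℕ) :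
    ∫ ω, (tracker W f α η ξ z₀ (k + 1) ω).dev.normSq ∂P
      ≤ (1 + mixRad W ^ 2) / 2 * ∫ ω, (tracker W f α η ξ z₀ k ω).dev.normSq ∂P
        + 6 / (1 - mixRad W ^ 2) * (2 * (specRad (offDiagPart W) ^ 2 * ση ^ 2) + L ^ 2 *
          (10 * ∫ ω, consErr (iterate W f α η ξ z₀ k ω).x ∂P
            + 2 * α ^ 2 * ∫ ω, (tracker W f α η ξ z₀ k ω).dev.normSq ∂P
            + 2 * n * α ^ 2 * L ^ 2 * ∫ ω, optErr xstar (iterate W f α η ξ z₀ k ω).x ∂P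
            + 2 * α ^ 2 * (specRad (offDiagPart W) ^ 2 * ση ^ 2)
            + specRad (offDiagPart W) ^ 2 * σξ ^ 2)) := by
  have hYi := isSqIntegrable_tracker (W := W) (α := α) (z₀ := z₀) hf hL.le h k
  have hYi' := isSqIntegrable_tracker (W := W) (α := α) (z₀ := z₀) hf hL.le h (k + 1)
  have hηi := h.isSqIntegrable_η (b := 0) k.lt_succ_self
  have hηi' := h.isSqIntegrable_η (b := 0) (k + 1).lt_succ_self
  have hXi := (isSqIntegrable_iterate (W := W) (α := α) (z₀ := z₀) hf hL.le h k).2.mono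
    (noiseSigma_mono η ξ k.le_succ k.le_succ)
  have hXi' := (isSqIntegrable_iterate (W := W) (α := α) (z₀ := z₀) hf hL.le h (k + 1)).2
  have hincr := integral_normSq_increment_le (z₀ := z₀) hf hW h hn hL hα hαL hT hx k
  set c := specRad (offDiagPart W) ^ 2 with hc
  have hc0 : 0 ≤ c := sq_nonneg _
  have i1 := hYi.dev.integrable_normSq.const_mul ((1 + mixRad W ^ 2) / 2)
  have i2 := hηi'.integrable_normSq.const_mul c
  have i3 := hηi.integrable_normSq.const_mul c
  have i4 := (hXi'.sub hXi).integrable_normSq.const_mul (L ^ 2)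
  have i5 := ((i2.add i3).add i4).const_mul (6 / (1 - mixRad W ^ 2))
  have hmono := integral_mono hYi'.dev.integrable_normSq (i1.add i5) fun ω =>
    normSq_dev_sIncr_algStep_le hf hn hW hT (η k ω) (η (k + 1) ω) (ξ k ω)
      (iterate W f α η ξ z₀ k ω)
  rw [integral_add' i1 i5, integral_const_mul, integral_const_mul, integral_add' (i2.add i3) i4,
    integral_add' i2 i3, integral_const_mul, integral_const_mul, integral_const_mul] at hmono
  refine hmono.trans (add_le_add_right ?_ _)
  have e1 := mul_le_mul_of_nonneg_left (h.variance_η k) hc0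
  have e2 := mul_le_mul_of_nonneg_left (h.variance_η (k + 1)) hc0
  have e3 := mul_le_mul_of_nonneg_left hincr (sq_nonneg L)
  refine mul_le_mul_of_nonneg_left ?_ (by positivity)
  linarith

/-- The recursion for the vector of the three mean square errors. -/
lemma meanSq_succ_le_rateMatrix (hn : 2 ≤ n) (hμ : 0 < μ) (hL : 0 < L) (hα : 0 < α)
    (hαL : α * (μ + L) < 1) (hT : 0 < 1 - mixRad W ^ 2)
    (hx : ∀ x, globalObj f xstar ≤ globalObj f x) {u : ℕ → Fin 3 → ℝ}
    (hu : u = fun k => ![∫ ω, optErr xstar (iterate W f α η ξ z₀ k ω).x ∂P,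
      ∫ ω, consErr (iterate W f α η ξ z₀ k ω).x ∂P,
      ∫ ω, (tracker W f α η ξ z₀ k ω).dev.normSq ∂P]) (k : ℕ) (i : Fin 3) :
    u (k + 1) i ≤ (rateMatrix n μ L α (devNorm n) (mixRad W) *ᵥ u k
      + noiseVec n L α (devNorm n) (mixRad W) (specRad (offDiagPart W)) ση σξ) i := by
  have hn0 : 0 < n := by omega
  have hn2 : (2 : ℝ) ≤ n := by exact_mod_cast hn
  have hαL' : α * L ≤ 1 := by nlinarith
  have hU := integral_optErr_succ_le (z₀ := z₀) hf hW h hn hμ hL hα hαL hx k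
  have hV := integral_consErr_succ_le (α := α) (z₀ := z₀) hf hW h hn0 hL hT k
  have hS := integral_tracker_succ_le (z₀ := z₀) hf hW h hn0 hL hα hαL' hT hx k
  have hU0 : 0 ≤ ∫ ω, optErr xstar (iterate W f α η ξ z₀ k ω).x ∂P :=
    integral_nonneg fun ω => sq_nonneg _
  have hV0 : 0 ≤ ∫ ω, consErr (iterate W f α η ξ z₀ k ω).x ∂P :=
    integral_nonneg fun ω => Stack.normSq_nonneg _
  have hS0 : 0 ≤ ∫ ω, (tracker W f α η ξ z₀ k ω).dev.normSq ∂P :=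
    integral_nonneg fun ω => Stack.normSq_nonneg _
  -- All the slack between the derived constants and those in A and B comes from d_I² ≥ 1 and n d_I²
  -- ≥ 2.
  have hd : 1 ≤ devNorm n ^ 2 := by rw [devNorm_sq hn0]; linarith
  have hnd : 2 ≤ n * devNorm n ^ 2 := by nlinarith
  subst hu
  beta_reduce
  generalize (∫ ω, optErr xstar (iterate W f α η ξ z₀ k ω).x ∂P) = a at *
  generalize (∫ ω, consErr (iterate W f α η ξ z₀ k ω).x ∂P) = b at *
  generalize (∫ ω, (tracker W f α η ξ z₀ k ω).dev.normSq ∂P) = c at *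
  fin_cases i
  · simp [rateMatrix, noiseVec]
    linarith
  · simp [rateMatrix, noiseVec]
    have hσ : specRad (offDiagPart W) ^ 2 * σξ ^ 2
        ≤ n * devNorm n ^ 2 * (specRad (offDiagPart W) ^ 2 * σξ ^ 2) :=
      le_mul_of_one_le_left (by positivity) (by linarith)
    linarith
  · simp [rateMatrix, noiseVec]
    refine hS.trans ?_
    generalize devNorm n ^ 2 = D at *
    have hσ : 0 ≤ specRad (offDiagPart W) ^ 2 * ση ^ 2 := by positivity
    have hσ' : 0 ≤ specRad (offDiagPart W) ^ 2 * σξ ^ 2 := by positivity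
    generalize specRad (offDiagPart W) ^ 2 = R at *
    -- The coefficients on the left are those of the derived third row, multiplied by T.
    have e1 : 12 * (n * α ^ 2 * L ^ 4 * a) ≤ 32 * D * (n * α ^ 2 * L ^ 4 * a) :=
      mul_le_mul_of_nonneg_right (by linarith) (by positivity)
    have e2 : 60 * (L ^ 2 * b) ≤ 64 * D * (L ^ 2 * b) :=
      mul_le_mul_of_nonneg_right (by linarith) (by positivity)
    have e3 : 12 * (α ^ 2 * L ^ 2 * c) ≤ 16 * D * (α ^ 2 * L ^ 2 * c) :=
      mul_le_mul_of_nonneg_right (by linarith) (by positivity)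
    have e4 : (12 + 12 * (α * L) ^ 2) * (R * ση ^ 2) ≤ 24 * (n * D) * (R * ση ^ 2) := by
      have : (α * L) ^ 2 ≤ 1 := pow_le_one₀ (by positivity) hαL'
      exact mul_le_mul_of_nonneg_right (by linarith) hσ
    have e5 : 6 * L ^ 2 * (R * σξ ^ 2) ≤ 4 * (n * D) * L ^ 2 * (R * σξ ^ 2) :=
      mul_le_mul_of_nonneg_right (mul_le_mul_of_nonneg_right (by linarith) (sq_nonneg L)) hσ'
    have e6 : 6 * (2 * (R * ση ^ 2) + L ^ 2 * (10 * b + 2 * α ^ 2 * c + 2 * n * α ^ 2 * L ^ 2 * a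
          + 2 * α ^ 2 * (R * ση ^ 2) + R * σξ ^ 2))
        ≤ 32 * D * (n * α ^ 2 * L ^ 4 * a) + 64 * D * (L ^ 2 * b)
          + 16 * D * (α ^ 2 * L ^ 2 * c) + 24 * (n * D) * (R * ση ^ 2)
          + 4 * (n * D) * L ^ 2 * (R * σξ ^ 2) := by linarith
    have e7 := mul_le_mul_of_nonneg_right e6 (inv_nonneg.2 hT.le)
    simp only [div_eq_mul_inv]
    linarith

end MeanSquare

/-! ### Assembly of the theorem. -/

theorem theorem3 {n r : ℕ} (hn : 2 ≤ n)
    -- objective functions and their minimizer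
    (μ L : ℝ) (hμ : 0 < μ) (hL : 0 < L) (f : Fin n → Vec r → ℝ)
    (hf : ∀ i, IsStronglyConvexSmooth μ L (f i))
    (xstar : Vec r) (hxstar : ∀ x, globalObj f xstar ≤ globalObj f x)
    -- coupling matrix
    (W : Matrix (Fin n) (Fin n) ℝ) (hW : IsCoupling W)
    -- noise
    {Ω : Type*} [MeasurableSpace Ω] (P : Measure Ω) [IsProbabilityMeasure P]
    (ση σξ : ℝ) (hση : 0 < ση) (hσξ : 0 < σξ)
    (η ξ : ℕ → Ω → Stack n r) (hnoise : IsNoise P ση σξ η ξ)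
    -- stepsize
    (α : ℝ) (hα : 0 < α) (hαlt : α < stepBound μ L (devNorm n) (mixRad W))
    -- arbitrary initialization
    (z₀ : AlgState n r) :
    let X : ℕ → Ω → Stack n r := fun k ω =>
      (algRun W f α (fun _ => 1) (fun _ => 1) (fun l => η l ω) (fun l => ξ l ω) z₀ k).x
    let U : ℕ → ℝ := fun k => ∫ ω, optErr xstar (X k ω) ∂P
    let V : ℕ → ℝ := fun k => ∫ ω, consErr (X k ω) ∂P
    let A : Matrix (Fin 3) (Fin 3) ℝ := rateMatrix n μ L α (devNorm n) (mixRad W)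
    let ρo : ℝ := specRad (offDiagPart W)
    let θ : Fin 3 → ℝ := errVec n μ L α (devNorm n) (mixRad W) ρo ση σξ
    let T : ℝ := 1 - mixRad W ^ 2
    -- the expectations are finite
    (∀ k, Integrable (fun ω => optErr xstar (X k ω)) P) ∧
    (∀ k, Integrable (fun ω => consErr (X k ω)) P) ∧
    -- `A` is nonnegative with spectral radius below one, and `I - A` is invertible
    (∀ i j, 0 ≤ A i j) ∧ specRad A < 1 ∧ IsUnit (1 - A).det ∧
    -- linear convergence to a neighborhood at rate `O(ρ(A)^k)`
    (∃ C : ℝ, ∀ k, U k ≤ θ 0 + C * specRad A ^ k ∧ V k ≤ θ 1 + C * specRad A ^ k) ∧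
    -- bounds on the limits superior
    BddAbove (Set.range U) ∧ BddAbove (Set.range V) ∧
    Tendsto (fun k : ℕ => ⨆ l : Set.Ici k, U (l : ℕ)) atTop (𝓝 (limsup U atTop)) ∧
    Tendsto (fun k : ℕ => ⨆ l : Set.Ici k, V (l : ℕ)) atTop (𝓝 (limsup V atTop)) ∧
    limsup U atTop ≤ θ 0 ∧ limsup V atTop ≤ θ 1 ∧
    -- explicit expressions of the bounds
    0 < errDen μ L α (devNorm n) T ∧
    θ 0 = errNum₁ μ L α (devNorm n) ση σξ T / errDen μ L α (devNorm n) T * ρo ^ 2 ∧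
    θ 1 = errNum₂ n μ L α (devNorm n) ση σξ T / errDen μ L α (devNorm n) T * ρo ^ 2 := by
  intro X U V A ρo θ T
  have hn0 : 0 < n := by omega
  have hn2 : (2 : ℝ) ≤ n := by exact_mod_cast hn
  have hd : 0 < devNorm n := by
    have h1 : 0 < devNorm n ^ 2 := by rw [devNorm_sq hn0]; linarith
    exact lt_of_le_of_ne (Real.sqrt_nonneg _) fun h0 => by rw [← h0] at h1; simp at h1
  obtain ⟨hαL, hT, hD⟩ := stepsize_facts hμ hL hα hd hαlt
  have hden : 0 < errDen μ L α (devNorm n) T := errDen_pos hμ hα hT hD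
  have hA : ∀ i j, 0 ≤ A i j := rateMatrix_nonneg hμ hL hα hαL hT
  obtain ⟨lam, hlam0, hlam1, v, hv, hAv⟩ :=
    exists_pos_eigenvector_rateMatrix (ρ := mixRad W) hn0 hμ hL hα hd hαL hT hden
  have hrad : specRad A = lam := specRad_eq_of_pos_eigenvector hA hv hlam0.le hAv
  have hunit : IsUnit (1 - A).det := by
    rw [isUnit_iff_ne_zero, det_one_sub_rateMatrix hn0 hμ hT]
    exact (div_pos hden (pow_pos hT 2)).ne'
  set u : ℕ → Fin 3 → ℝ := fun k => ![U k, V k,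
    ∫ ω, (tracker W f α η ξ z₀ k ω).dev.normSq ∂P] with hu
  have hrec : ∀ k i, u (k + 1) i
      ≤ (A *ᵥ u k + noiseVec n L α (devNorm n) (mixRad W) ρo ση σξ) i :=
    meanSq_succ_le_rateMatrix hf hW hnoise hn hμ hL hα hαL hT hxstar hu
  have hfix : A *ᵥ θ + noiseVec n L α (devNorm n) (mixRad W) ρo ση σξ = θ := by
    have h1 : (1 - A) *ᵥ θ = noiseVec n L α (devNorm n) (mixRad W) ρo ση σξ :=
      one_sub_rateMatrix_mulVec_errVec hunit
    rw [← h1, Matrix.sub_mulVec, Matrix.one_mulVec, add_sub_cancel]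
  -- Subtracting the fixed point θ = Aθ + B removes the noise vector and leaves a homogeneous
  -- inequality.
  obtain ⟨C, hC⟩ := exists_le_mul_pow_of_le_mulVec (u := fun k => u k - θ) hA hv hlam0.le hAv
    fun k i => by
      have h1 := hrec k i
      have h2 := congrFun hfix i
      simp only [Pi.add_apply] at h1 h2
      rw [Pi.sub_apply, Matrix.mulVec_sub, Pi.sub_apply]
      linarith
  have hUle : ∀ k, U k ≤ θ 0 + C * lam ^ k := fun k => by
    have := hC k 0
    simp only [hu, Pi.sub_apply, Matrix.cons_val_zero] at this
    linarith
  have hVle : ∀ k, V k ≤ θ 1 + C * lam ^ k := fun k => by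
    have := hC k 1
    simp only [hu, Pi.sub_apply, Matrix.cons_val_one, Matrix.cons_val_zero] at this
    linarith
  have hUb : BddBelow (Set.range U) :=
    ⟨0, by rintro _ ⟨k, rfl⟩; exact integral_nonneg fun ω => sq_nonneg _⟩
  have hVb : BddBelow (Set.range V) :=
    ⟨0, by rintro _ ⟨k, rfl⟩; exact integral_nonneg fun ω => Stack.normSq_nonneg _⟩
  have hUa := bddAbove_of_le_add_mul_pow hlam0.le hlam1 hUle
  have hVa := bddAbove_of_le_add_mul_pow hlam0.le hlam1 hVle
  obtain ⟨hθ0, hθ1⟩ := errVec_eq (ρo := ρo) (ση := ση) (σξ := σξ) hn0 hμ hT hden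
  refine ⟨integrable_optErr hf hL.le hn0 hnoise, integrable_consErr hf hL.le hnoise, hA,
    hrad.trans_lt hlam1, hunit, ⟨C, fun k => ?_⟩, hUa, hVa, tendsto_iSup_Ici_limsup hUa hUb,
    tendsto_iSup_Ici_limsup hVa hVb, limsup_le_of_le_add_mul_pow hUb hlam0.le hlam1 hUle,
    limsup_le_of_le_add_mul_pow hVb hlam0.le hlam1 hVle, hden, hθ0, hθ1⟩
  rw [hrad]
  exact ⟨hUle k, hVle k⟩
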